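/- **Setting.** Consider the dynamic panel model $$y_{i,t}=\sum_{l=1}^{L}\alpha_l\,y_{i,t-l}+x_{i,t}'\beta+\eta_i+\varepsilon_{i,t}=z_{i,t}'\alpha+\eta_i+\varepsilon_{i,t},\qquad i=1,\dots,N,\ t=1,\dots,T,$$ with $N,T\ge 1$, $x_{i,t}\in\mathbb R^{p_x}$, initial observations $y_{i,0},\dots,y_{i,1-L}$, $z_{i,t}=(y_{i,t-1},\dots,y_{i,t-L},x_{i,t}')'$, $\alpha=(\alpha_1,\dots,\alpha_L,\beta')'\in\mathbb R^p$, $p=L+p_x$, and fixed effects $\eta=(\eta_1,\dots,\eta_N)'$. Let $y$ be the vector of all $y_{i,t}$ ($1\le t\le T$), $Z$ the $NT\times p$ matrix with rows $z_{i,t}'$, $D=I_N\otimes(1,\dots,1)'$ the $NT\times N$ matrix of individual dummies, $\Pi=(Z,D)$ and $\gamma=(\alpha',\eta')'$. For $\lambda_N\ge 0$, the panel Lasso $\hat\gamma=(\hat\alpha',\hat\eta')'$ is any minimiser of $$\|y-\Pi\gamma\|^2+2\lambda_N\|\alpha\|_1+2\frac{\lambda_N}{\sqrt N}\|\eta\|_1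 .$$ For $1\le s_1\le p$, $0\le\nu<1$, $E>0$ let $$\mathcal F(s_1,\nu,E)=\{\alpha\in\mathbb R^p:\|\alpha\|_0\le s_1\}\times\Big\{\eta\in\mathbb R^N:\sum_{i=1}^N|\eta_i|^\nu\le E\Big\}$$ (with $0^0=0$ when $\nu=0$, the case of exact sparsity). Let $\Psi_Z=\frac1{NT}\sum_{i=1}^N\sum_{t=1}^T\mathbb E[z_{i,t}z_{i,t}']$ and $$\kappa_2^2=1\wedge\min_{\substack{R\subseteq\{1,\dots,p\},\,|R|\le s_1}}\ \min_{\delta\in\mathbb R^p,\ \delta_R\ne 0}\frac{\delta'\Psi_Z\delta}{\delta_R'\delta_R}.$$ **Assumptions.** For positive constants $C,K,\kappa_0,C_0$: 1. the blocks $(y_{i,0},\dots,y_{i,1-L},x_{i,1}',\dots,x_{i,T}',\varepsilon_{i,1},\dots,\varepsilon_{i,T})$, $i=1,\dots,N$, are independent, and $\mathbb E[\varepsilon_{i,t}\mid y_{i,t-1},\dots,y_{i,1-L},x_{i,t},\dots,x_{i,1}]=0$ for all $i,t$; 2. $\kappa_2^2\ge\kappa_0$; 3. $\mathbb P(|\varepsilon_{i,t}|\ge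 u)\le\frac12Ke^{-Cu^2}$ and $\mathbb P(|z_{i,t,l}|\ge u)\le\frac12Ke^{-Cu^2}$ for all $u\ge0$, $i$, $t$, $l$. **Theorem (oracle inequalities).** For all $C,K,\kappa_0,C_0>0$ there are constants $A,B>0$, depending only on these four numbers, such that the following holds for all $N,T,L,p_x$, all $1\le s_1\le p$, $0\le\nu<1$, $E>0$ and $M>0$. Put $\lambda_N=\sqrt{4MNT(\log(p\vee N))^3}$ and suppose that $s_1+E\big(\frac{\lambda_N}{\sqrt NT}\big)^{-\nu}\le C_0\sqrt N$. Then, for every $(\alpha,\eta)\in\mathcal F(s_1,\nu,E)$ and all data that follow the model with these parameters and satisfy assumptions 1–3, with probability at least $$1-Ap^{1-BM^{1/3}}-AN^{1-BM^{1/3}}-A(p^2+pN)\exp\left(-B\left\{N\Big/\Big[s_1+E\Big(\frac{\lambda_N}{\sqrt NT}\Big)^{-\nu}\Big]^2\right\}^{1/3}\right)$$ every panel Lasso solution $\hat\gamma$ satisfies the three inequalities $$\frac1{NT}\|\Pi(\hat\gamma-\gamma)\|^2\le\frac{120\lambda_N^2s_1}{\kappa_2^2(NT)^2}+\Big(\frac{120}{\kappa_2^2}+20\Big)\frac{\lambda_N}{\sqrt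 N\,NT}\,E\Big(\frac{\lambda_N}{\sqrt NT}\Big)^{1-\nu},$$ $$\|\hat\alpha-\alpha\|_1\le\frac{120\lambda_Ns_1}{\kappa_2^2NT}+\Big(\frac{120}{\kappa_2^2}+20\Big)\frac1{\sqrt N}\,E\Big(\frac{\lambda_N}{\sqrt NT}\Big)^{1-\nu},$$ $$\|\hat\eta-\eta\|_1\le\frac{120\lambda_Ns_1}{\kappa_2^2\sqrt NT}+\Big(\frac{120}{\kappa_2^2}+20\Big)E\Big(\frac{\lambda_N}{\sqrt NT}\Big)^{1-\nu}.$$ In particular the bounds are uniform over $\mathcal F(s_1,\nu,E)$. -/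

import Mathlib

open MeasureTheory ProbabilityTheory
open scoped Matrix

/-- The random variables of a dynamic panel with `N` individuals, `T` periods, `L` lags and `px`
exogenous regressors. `y i s` is the response at the (integer) time `s`; only the times
`1 - L, …, T` matter, the times `1 - L, …, 0` being the initial observations.
The element `t : Fin T` stands for the time `t + 1`, so `x i t`, `ε i t` are the regressor vector
and the error of individual `i` at time `t + 1`. -/
structure PanelData (Ω : Type*) [MeasurableSpace Ω] (N T L px : ℕ) where
  y : Fin N → ℤ → Ω → ℝ
  x : Fin N → Fin T → Ω → (Fin px → ℝ)
  ε : Fin N → Fin T → Ω → ℝ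
  measurable_y : ∀ i, ∀ s : ℤ, 1 - (L : ℤ) ≤ s → s ≤ (T : ℤ) → Measurable (y i s)
  measurable_x : ∀ i t, Measurable (x i t)
  measurable_ε : ∀ i t, Measurable (ε i t)

namespace PanelData

variable {Ω : Type*} [MeasurableSpace Ω] {N T L px : ℕ}

/-- The regressor vector `z_{i,t} = (y_{i,t-1}, …, y_{i,t-L}, x_{i,t}')'`; the index `Sum.inl l`
is the lag of order `l + 1`. -/
def z (d : PanelData Ω N T L px) (i : Fin N) (t : Fin T) (ω : Ω) : Fin L ⊕ Fin px → ℝ :=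
  Sum.elim (fun l => d.y i (((t : ℤ) + 1) - ((l : ℤ) + 1)) ω) (fun k => d.x i t ω k)

/-- The dynamic panel equation `y_{i,t} = z_{i,t}' α + η_i + ε_{i,t}`. -/
def SatisfiesModel (d : PanelData Ω N T L px) (α : Fin L ⊕ Fin px → ℝ) (η : Fin N → ℝ) : Prop :=
  ∀ (i : Fin N) (t : Fin T) (ω : Ω), d.y i ((t : ℤ) + 1) ω = d.z i t ω ⬝ᵥ α + η i + d.ε i t ω

/-- The vector of stacked responses. -/
def Y (d : PanelData Ω N T L px) (ω : Ω) : Fin N × Fin T → ℝ :=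
  fun r => d.y r.1 ((r.2 : ℤ) + 1) ω

/-- The stacked matrix `Z`, with rows `z_{i,t}'`. -/
def Z (d : PanelData Ω N T L px) (ω : Ω) : Matrix (Fin N × Fin T) (Fin L ⊕ Fin px) ℝ :=
  Matrix.of fun r j => d.z r.1 r.2 ω j

/-- The matrix `D = I_N ⊗ ι` of individual dummies. -/
def dummies (N T : ℕ) : Matrix (Fin N × Fin T) (Fin N) ℝ :=
  Matrix.of fun r j => if r.1 = j then 1 else 0

/-- The design matrix `Π = (Z, D)`. -/
def design (d : PanelData Ω N T L px) (ω : Ω) :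
    Matrix (Fin N × Fin T) ((Fin L ⊕ Fin px) ⊕ Fin N) ℝ :=
  Matrix.fromCols (d.Z ω) (dummies N T)

/-- The σ-algebra generated by `y_{i,t-1}, …, y_{i,1-L}, x_{i,t}, …, x_{i,1}`. -/
@[reducible] def past (d : PanelData Ω N T L px) (i : Fin N) (t : Fin T) : MeasurableSpace Ω :=
  (⨆ s : {s : ℤ // 1 - (L : ℤ) ≤ s ∧ s ≤ ((t : ℤ) + 1) - 1},
      MeasurableSpace.comap (d.y i s) inferInstance) ⊔
    ⨆ t' : {t' : Fin T // t' ≤ t}, MeasurableSpace.comap (d.x i t') inferInstance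

/-- All the variables that generate the data of individual `i`: the initial observations
`y_{i,0}, …, y_{i,1-L}`, the regressors and the errors. -/
def block (d : PanelData Ω N T L px) (i : Fin N) (ω : Ω) :
    (Fin L → ℝ) × (Fin T → Fin px → ℝ) × (Fin T → ℝ) :=
  (fun l => d.y i (-(l : ℤ)) ω, fun t => d.x i t ω, fun t => d.ε i t ω)

/-- Independence across individuals, and errors with conditional mean zero given the past. -/
def IndepExogenous (d : PanelData Ω N T L px) (P : Measure Ω) : Prop :=
  iIndepFun (fun i => d.block i) P ∧ ∀ i t, P[d.ε i t | d.past i t] =ᵐ[P] 0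

/-- Uniform subgaussianity of the errors and of the regressors, with constants `C` and `K`. -/
def Subgaussian (d : PanelData Ω N T L px) (P : Measure Ω) (C K : ℝ) : Prop :=
  (∀ i t, ∀ u : ℝ, 0 ≤ u →
      P.real {ω | u ≤ |d.ε i t ω|} ≤ 1 / 2 * K * Real.exp (-C * u ^ 2)) ∧
    ∀ i t j, ∀ u : ℝ, 0 ≤ u →
      P.real {ω | u ≤ |d.z i t ω j|} ≤ 1 / 2 * K * Real.exp (-C * u ^ 2)

/-- The population second moment matrix `Ψ_Z = (NT)⁻¹ ∑_i ∑_t E[z_{i,t} z_{i,t}']`. -/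
noncomputable def secondMoment (d : PanelData Ω N T L px) (P : Measure Ω) :
    Matrix (Fin L ⊕ Fin px) (Fin L ⊕ Fin px) ℝ :=
  Matrix.of fun j k =>
    1 / ((N : ℝ) * T) * ∑ i : Fin N, ∑ t : Fin T, ∫ ω, d.z i t ω j * d.z i t ω k ∂P

end PanelData

/-- The `ℓ₁` norm. -/
def l1Norm {ι : Type*} [Fintype ι] (v : ι → ℝ) : ℝ := ∑ j, |v j|

/-- The square of the Euclidean norm. -/
def sqNorm {ι : Type*} [Fintype ι] (v : ι → ℝ) : ℝ := ∑ j, v j ^ 2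

/-- The number of nonzero entries. -/
noncomputable def l0Norm {ι : Type*} [Fintype ι] (v : ι → ℝ) : ℕ := {j | v j ≠ 0}.ncard

/-- `κ₂²(Ψ_Z, s) = 1 ∧ min δ'Ψ_Zδ / (δ_R'δ_R)`, over the index sets `R` with `|R| ≤ s` and the
vectors `δ` with `δ_R ≠ 0`. The vector `δ` is not restricted to a cone: it is the first block of a
vector `(δ, δ₂)` such that the entries of both blocks outside of `R ∪ R₂` are dominated, in
`ℓ₁`-norm, by four times those inside, for some nonempty `R₂`; as `δ₂` is arbitrary, this does not
restrict `δ`. -/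
noncomputable def kappaSq {ι : Type*} [Fintype ι] (Ψ : Matrix ι ι ℝ) (s : ℕ) : ℝ :=
  min 1 (sInf {q : ℝ | ∃ (R : Finset ι) (δ : ι → ℝ), R.card ≤ s ∧ 0 < ∑ j ∈ R, δ j ^ 2 ∧
    q = (δ ⬝ᵥ (Ψ *ᵥ δ)) / ∑ j ∈ R, δ j ^ 2})

/-- The class `F(s₁, ν, E)`: `‖α‖₀ ≤ s₁` and `∑ |η_i|^ν ≤ E`. The sum runs over the nonzero `η_i`,
which matters only if `ν = 0`, where it amounts to the convention `0⁰ = 0`. -/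
def sparseClass {ι : Type*} [Fintype ι] (N s₁ : ℕ) (ν E : ℝ) : Set ((ι → ℝ) × (Fin N → ℝ)) :=
  {θ | l0Norm θ.1 ≤ s₁ ∧ ∑ i with θ.2 i ≠ 0, |θ.2 i| ^ ν ≤ E}

/-- The regularization level `λ_N = √(4 M N T (log (p ∨ N))³)`. -/
noncomputable def lambdaN (M : ℝ) (N T p : ℕ) : ℝ :=
  √(4 * M * N * T * Real.log (max (p : ℝ) N) ^ 3)

/-- The panel Lasso objective function at `γ = (a', h')'`. -/
noncomputable def lassoObjective {Ω : Type*} [MeasurableSpace Ω] {N T L px : ℕ}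
    (d : PanelData Ω N T L px) (lam : ℝ) (ω : Ω) (a : Fin L ⊕ Fin px → ℝ) (h : Fin N → ℝ) : ℝ :=
  sqNorm (d.Y ω - d.design ω *ᵥ Sum.elim a h) + 2 * lam * l1Norm a + 2 * (lam / √N) * l1Norm h

/-- `(a', h')'` minimises the panel Lasso objective function at the sample point `ω`. -/
def IsPanelLasso {Ω : Type*} [MeasurableSpace Ω] {N T L px : ℕ}
    (d : PanelData Ω N T L px) (lam : ℝ) (ω : Ω) (a : Fin L ⊕ Fin px → ℝ) (h : Fin N → ℝ) : Prop :=
  ∀ a' h', lassoObjective d lam ω a h ≤ lassoObjective d lam ω a' h'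

/-! The proof separates a deterministic inequality from the probability of the event on which it
applies.

Deterministic part. Suppose that the entries of `Z'ε` and `D'ε` are at most half of their penalty
weights. Comparing the Lasso with the truth then bounds prediction error plus weighted ℓ₁ error by
the ℓ₁ error on a set of active coordinates, plus the ℓ₁ mass of the truth off that set
(`IsPanelLasso.basic_inequality`). Active are the support of `α` and the effects larger than `Ξ =
λ/(√N T)`: at most `s = s₁ + E Ξ^(-ν)` coordinates, with mass at most `E Ξ^(1-ν)` left over. In the
coordinates `(α, η/√N)` the scaled Gram matrix is compared with `diag(Ψ_Z, I)`, whose restricted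
eigenvalue is at least `κ₂²` because `κ₂² ≤ 1`. An entrywise error `m` costs `m` times the squared
ℓ₁ error, which is absorbed when `256 m s ≤ κ₂²` (`sqNorm_design_mulVec_ge`,
`rate_of_basic_inequality`).

Probabilistic part. Products of subgaussian variables have exponential moments, and `z ε` and `ε`
are martingale differences in time, independent across individuals. In `measureReal_sum_ge_le` they
are truncated at `u` and recentred conditionally; Azuma–Hoeffding handles the bounded part and
Chebyshev the remainder. Both tails are exponential in `u` at the threshold `√(n u³)`, whence the
cubed logarithm in `λ` and the cube roots in the exponents. Nothing is assumed about dependence over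
time, so the Gram matrix concentrates only through the `N` independent individual time averages.
With `m` proportional to `1/s` this gives the exponent `(N/s²)^(1/3)`. A union bound over all
entries concludes. -/

/-- `X` has an exponential moment of order `c` that is at most `K`. -/
def ExpMomentLE {Ω : Type*} [MeasurableSpace Ω] (P : Measure Ω) (c K : ℝ) (X : Ω → ℝ) : Prop :=
  Integrable (fun ω => Real.exp (c * |X ω|)) P ∧ ∫ ω, Real.exp (c * |X ω|) ∂P ≤ K

/-! ### Truncation at a fixed level. -/

section Truncation

variable {Ω : Type*}

lemma sq_le_exp_mul_abs {c : ℝ} (hc : 0 < c) (x : ℝ) : x ^ 2 ≤ 2 / c ^ 2 * Real.exp (c * |x|) := by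
  have h := Real.quadratic_le_exp_of_nonneg (x := c * |x|) (by positivity)
  have h2 : (c * |x|) ^ 2 / 2 ≤ Real.exp (c * |x|) := by
    have : 0 ≤ c * |x| := by positivity
    linarith
  rw [mul_pow, sq_abs] at h2
  rw [div_mul_eq_mul_div, le_div_iff₀ (by positivity)]
  linarith

/-- Truncation of `X` at the level `u`. -/
noncomputable def truncAbs (u : ℝ) (X : Ω → ℝ) (ω : Ω) : ℝ := if |X ω| ≤ u then X ω else 0

lemma abs_truncAbs_le {u : ℝ} (hu : 0 ≤ u) (X : Ω → ℝ) (ω : Ω) : |truncAbs u X ω| ≤ u := by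
  unfold truncAbs
  split_ifs with h
  · exact h
  · simpa using hu

lemma measurable_truncAbs [MeasurableSpace Ω] (u : ℝ) {X : Ω → ℝ} (hX : Measurable X) :
    Measurable (truncAbs u X) :=
  Measurable.ite (measurableSet_le (by fun_prop) measurable_const) hX measurable_const

/-- Only `|X| > u` contributes. There `X²` is bounded through half of the exponent, and the other
half supplies the factor `exp (-cu/2)`. -/
lemma sq_sub_truncAbs_le {c u : ℝ} (hc : 0 < c) (X : Ω → ℝ) (ω : Ω) :
    (X ω - truncAbs u X ω) ^ 2
      ≤ 8 / c ^ 2 * Real.exp (-(c * u / 2)) * Real.exp (c * |X ω|) := by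
  unfold truncAbs
  split_ifs with h
  · simp only [sub_self, ne_eq, OfNat.ofNat_ne_zero, not_false_eq_true, zero_pow]
    positivity
  · push Not at h
    have h1 := sq_le_exp_mul_abs (half_pos hc) (X ω)
    rw [sub_zero]
    refine h1.trans ?_
    rw [mul_assoc, ← Real.exp_add]
    have : 2 / (c / 2) ^ 2 = 8 / c ^ 2 := by field_simp; norm_num
    rw [this]
    gcongr
    nlinarith

end Truncation

/-! ### Exponential moments and conditionally centred truncations. -/

section Moments

variable {Ω : Type*} {m : MeasurableSpace Ω} [mΩ : MeasurableSpace Ω] {P : Measure Ω}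

lemma ExpMomentLE.integrable_sq {c K : ℝ} {X : Ω → ℝ} (h : ExpMomentLE P c K X) (hc : 0 < c)
    (hX : AEStronglyMeasurable X P) : Integrable (fun ω => X ω ^ 2) P := by
  refine (h.1.const_mul (2 / c ^ 2)).mono' (hX.pow 2) (ae_of_all _ fun ω => ?_)
  rw [Real.norm_of_nonneg (sq_nonneg _)]
  exact sq_le_exp_mul_abs hc _

lemma ExpMomentLE.memLp_two {c K : ℝ} {X : Ω → ℝ} (h : ExpMomentLE P c K X) (hc : 0 < c)
    (hX : AEStronglyMeasurable X P) : MemLp X 2 P :=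
  (memLp_two_iff_integrable_sq hX).2 (h.integrable_sq hc hX)

lemma ExpMomentLE.mono {c K c' K' : ℝ} {X : Ω → ℝ} (h : ExpMomentLE P c K X) (hcc : c' ≤ c)
    (hK : K ≤ K') (hX : AEStronglyMeasurable X P) : ExpMomentLE P c' K' X := by
  have hle : ∀ ω, Real.exp (c' * |X ω|) ≤ Real.exp (c * |X ω|) := fun ω => by gcongr
  have hint : Integrable (fun ω => Real.exp (c' * |X ω|)) P := by
    refine h.1.mono' ?_ (ae_of_all _ fun ω => ?_)
    · exact Real.continuous_exp.comp_aestronglyMeasurable (hX.norm.const_mul c')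
    · rw [Real.norm_of_nonneg (Real.exp_pos _).le]
      exact hle ω
  exact ⟨hint, (integral_mono hint h.1 hle).trans (h.2.trans hK)⟩

lemma ExpMomentLE.of_le_const_mul {K c' A : ℝ} {X Y : Ω → ℝ} (h : Integrable Y P)
    (hK : ∫ ω, Y ω ∂P ≤ K) (hA : 0 ≤ A) (hX : AEStronglyMeasurable X P)
    (hle : ∀ ω, Real.exp (c' * |X ω|) ≤ A * Y ω) : ExpMomentLE P c' (A * K) X := by
  have hint : Integrable (fun ω => Real.exp (c' * |X ω|)) P := by
    refine (h.const_mul A).mono' ?_ (ae_of_all _ fun ω => ?_)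
    · exact Real.continuous_exp.comp_aestronglyMeasurable (hX.norm.const_mul c')
    · rw [Real.norm_of_nonneg (Real.exp_pos _).le]
      exact hle ω
  refine ⟨hint, (integral_mono hint (h.const_mul A) hle).trans ?_⟩
  rw [integral_const_mul]
  gcongr

lemma ExpMomentLE.nonneg {c K : ℝ} {X : Ω → ℝ} (h : ExpMomentLE P c K X) : 0 ≤ K :=
  (integral_nonneg fun _ => (Real.exp_pos _).le).trans h.2

/-- Markov's inequality for a variable with an exponential moment. -/
lemma ExpMomentLE.measureReal_le {c K : ℝ} {X : Ω → ℝ} (h : ExpMomentLE P c K X) (hc : 0 < c)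
    (u : ℝ) : P.real {ω | u ≤ |X ω|} ≤ K * Real.exp (-(c * u)) := by
  have h1 := mul_meas_ge_le_integral_of_nonneg (ae_of_all _ fun ω => (Real.exp_pos _).le) h.1
    (Real.exp (c * u))
  have h2 : {ω | Real.exp (c * u) ≤ Real.exp (c * |X ω|)} = {ω | u ≤ |X ω|} := by
    ext ω
    simp [hc]
  rw [h2] at h1
  rw [Real.exp_neg, ← div_eq_mul_inv, le_div_iff₀ (Real.exp_pos _), mul_comm]
  exact h1.trans h.2

lemma ExpMomentLE.integral_sq_sub_truncAbs_le {c K : ℝ} {X : Ω → ℝ} (h : ExpMomentLE P c K X)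
    (hc : 0 < c) (hX : Measurable X) (u : ℝ) :
    ∫ ω, (X ω - truncAbs u X ω) ^ 2 ∂P ≤ 8 / c ^ 2 * Real.exp (-(c * u / 2)) * K := by
  have hle := sq_sub_truncAbs_le (u := u) hc X
  have hm := (hX.sub (measurable_truncAbs u hX)).pow_const 2
  calc _ ≤ ∫ ω, 8 / c ^ 2 * Real.exp (-(c * u / 2)) * Real.exp (c * |X ω|) ∂P := by
        refine integral_mono ?_ (h.1.const_mul _) hle
        refine (h.1.const_mul (8 / c ^ 2 * Real.exp (-(c * u / 2)))).mono'
          hm.aestronglyMeasurable (ae_of_all _ fun ω => ?_)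
        rw [Real.norm_of_nonneg (sq_nonneg _)]
        exact hle ω
    _ ≤ _ := by
        rw [integral_const_mul]
        gcongr
        exact h.2

/-- Conditional variance is at most the conditional second moment; integrate both. -/
lemma integral_sq_sub_condExp_le [IsProbabilityMeasure P] (hm : m ≤ mΩ)
    {X : Ω → ℝ} (hX : MemLp X 2 P) : ∫ ω, (X ω - (P[X | m]) ω) ^ 2 ∂P ≤ ∫ ω, X ω ^ 2 ∂P := by
  have h1 : ∫ ω, (X ω - (P[X | m]) ω) ^ 2 ∂P = ∫ ω, (Var[X; P | m]) ω ∂P :=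
    (integral_condExp hm).symm
  have h2 : ∫ ω, X ω ^ 2 ∂P = ∫ ω, (P[X ^ 2 | m]) ω ∂P := (integral_condExp hm).symm
  rw [h1, h2]
  exact integral_mono_ae integrable_condVar integrable_condExp (condVar_ae_le_condExp_sq hm hX)

lemma integral_mul_eq_zero_of_condExp_eq_zero [IsProbabilityMeasure P]
    (hm : m ≤ mΩ) {Y X : Ω → ℝ} (hY : StronglyMeasurable[m] Y) (hX : Integrable X P)
    (hYX : Integrable (fun ω => Y ω * X ω) P) (h0 : P[X | m] =ᵐ[P] 0) :
    ∫ ω, Y ω * X ω ∂P = 0 := by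
  have h : P[fun ω => Y ω * X ω | m] =ᵐ[P] _ := condExp_mul_of_stronglyMeasurable_left hY hYX hX
  rw [← integral_condExp hm, integral_congr_ae h, integral_congr_ae (g := fun _ => 0)]
  · simp
  · filter_upwards [h0] with ω hω
    simp [hω]

/-- The conditionally centred truncation. -/
noncomputable def truncDiff {Ω : Type*} (m : MeasurableSpace Ω) [mΩ : MeasurableSpace Ω]
    (P : Measure Ω) (u : ℝ) (X : Ω → ℝ) : Ω → ℝ :=
  fun ω => truncAbs u X ω - (P[truncAbs u X | m]) ω

lemma abs_truncDiff_le {u : ℝ} (hu : 0 ≤ u) (X : Ω → ℝ) :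
    ∀ᵐ ω ∂P, |truncDiff m P u X ω| ≤ 2 * u := by
  have h : ∀ᵐ ω ∂P, |(P[truncAbs u X | m]) ω| ≤ u :=
    ae_bdd_abs_condExp_of_ae_bdd_abs (ae_of_all _ fun ω => abs_truncAbs_le hu X ω)
  filter_upwards [h] with ω hω
  have h1 := abs_truncAbs_le hu X ω
  have h2 : |(P[truncAbs u X | m]) ω| ≤ u := hω
  calc _ ≤ |truncAbs u X ω| + |(P[truncAbs u X | m]) ω| := abs_sub _ _
    _ ≤ _ := by linarith

variable [IsProbabilityMeasure P]

lemma measurable_truncDiff {Ω : Type*} {m m' mΩ : MeasurableSpace Ω} {P : Measure Ω} {u : ℝ}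
    {X : Ω → ℝ} (hX : Measurable[m'] X) (hm : m ≤ m') : Measurable[m'] (truncDiff m P u X) :=
  (@measurable_truncAbs Ω m' u X hX).sub (stronglyMeasurable_condExp.measurable.mono hm le_rfl)

lemma integrable_truncAbs {u : ℝ} (hu : 0 ≤ u) {X : Ω → ℝ} (hX : Measurable X) :
    Integrable (truncAbs u X) P :=
  Integrable.of_bound (measurable_truncAbs u hX).aestronglyMeasurable u
    (ae_of_all _ fun ω => abs_truncAbs_le hu X ω)

lemma condExp_truncDiff (hm : m ≤ mΩ) {u : ℝ} (hu : 0 ≤ u) {X : Ω → ℝ} (hX : Measurable X) :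
    P[truncDiff m P u X | m] =ᵐ[P] 0 := by
  have h1 : P[truncAbs u X - P[truncAbs u X | m] | m] =ᵐ[P] _ :=
    condExp_sub (integrable_truncAbs hu hX) integrable_condExp m
  have h2 : P[P[truncAbs u X | m] | m] = P[truncAbs u X | m] :=
    condExp_of_stronglyMeasurable hm stronglyMeasurable_condExp integrable_condExp
  refine h1.trans ?_
  rw [h2, sub_self]

lemma integrable_truncDiff {u : ℝ} (hu : 0 ≤ u) {X : Ω → ℝ} (hX : Measurable X) :
    Integrable (truncDiff m P u X) P :=
  (integrable_truncAbs hu hX).sub integrable_condExp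

lemma memLp_truncDiff (hm : m ≤ mΩ) {u : ℝ} (hu : 0 ≤ u) {X : Ω → ℝ} (hX : Measurable X) :
    MemLp (truncDiff m P u X) 2 P :=
  MemLp.of_bound (measurable_truncDiff hX hm).aestronglyMeasurable (2 * u) (abs_truncDiff_le hu X)

/-- Since `X` is conditionally centred, the remainder equals `X - truncAbs u X` minus its own
conditional mean, so recentring does not increase its second moment. -/
lemma ExpMomentLE.integral_sq_sub_truncDiff_le {c K : ℝ} {X : Ω → ℝ} (h : ExpMomentLE P c K X)
    (hc : 0 < c) (hX : Measurable X) (hm : m ≤ mΩ) {u : ℝ} (hu : 0 ≤ u)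
    (h0 : P[X | m] =ᵐ[P] 0) :
    ∫ ω, (X ω - truncDiff m P u X ω) ^ 2 ∂P ≤ 8 / c ^ 2 * Real.exp (-(c * u / 2)) * K := by
  have hX2 := h.memLp_two hc hX.aestronglyMeasurable
  have hf : MemLp (truncAbs u X) 2 P :=
    MemLp.of_bound (measurable_truncAbs u hX).aestronglyMeasurable u
      (ae_of_all _ fun ω => abs_truncAbs_le hu X ω)
  refine le_trans (le_of_eq ?_) ((integral_sq_sub_condExp_le hm (hX2.sub hf)).trans
    (h.integral_sq_sub_truncAbs_le hc hX u))
  refine integral_congr_ae ?_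
  have h1 : P[X - truncAbs u X | m] =ᵐ[P] _ :=
    condExp_sub (hX2.integrable (by norm_num)) (integrable_truncAbs hu hX) m
  filter_upwards [h1, h0] with ω h1 h0
  rw [h1]
  simp only [Pi.sub_apply, h0, truncDiff, Pi.zero_apply]
  ring

lemma condExp_sub_truncDiff {X : Ω → ℝ} (hX : Measurable X) (hXi : Integrable X P)
    (hm : m ≤ mΩ) {u : ℝ} (hu : 0 ≤ u) (h0 : P[X | m] =ᵐ[P] 0) :
    P[fun ω => X ω - truncDiff m P u X ω | m] =ᵐ[P] 0 := by
  have h1 : P[X - truncDiff m P u X | m] =ᵐ[P] _ :=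
    condExp_sub hXi (integrable_truncDiff hu hX) m
  refine h1.trans ?_
  filter_upwards [h0, condExp_truncDiff hm hu hX] with ω h2 h3
  simp [h2, h3]

end Moments

/-! ### Deviation inequalities for independent martingale difference sequences. -/

section MartingaleDifferences

variable {Ω : Type*} [mΩ : MeasurableSpace Ω] {P : Measure Ω}

lemma integral_sq_sum_eq {ι : Type*} [Fintype ι] {H : ι → Ω → ℝ} (hH : ∀ i, MemLp (H i) 2 P)
    (horth : ∀ i j, i ≠ j → ∫ ω, H i ω * H j ω ∂P = 0) :
    ∫ ω, (∑ i, H i ω) ^ 2 ∂P = ∑ i, ∫ ω, H i ω ^ 2 ∂P := by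
  classical
  have hint : ∀ i j, Integrable (fun ω => H i ω * H j ω) P := fun i j => (hH i).integrable_mul (hH j)
  simp_rw [pow_two, Finset.sum_mul_sum]
  rw [integral_finsetSum _ fun i _ => integrable_finsetSum _ fun j _ => hint i j]
  refine Finset.sum_congr rfl fun i _ => ?_
  rw [integral_finsetSum _ fun j _ => hint i j]
  exact Finset.sum_eq_single i (fun j _ hj => horth i j hj.symm) (by simp)

variable [IsProbabilityMeasure P]

lemma integrable_exp_mul_sum {ι : Type*} [Fintype ι] {g : ι → Ω → ℝ} {b : ℝ} (s : ℝ)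
    (hg : ∀ i, Measurable (g i)) (hb : ∀ i, ∀ᵐ ω ∂P, |g i ω| ≤ b) :
    Integrable (fun ω => Real.exp (s * ∑ i, g i ω)) P := by
  refine Integrable.of_bound (C := Real.exp (|s| * ∑ _i : ι, b)) ?_ ?_
  · exact (by fun_prop : Measurable fun ω => Real.exp (s * ∑ i, g i ω)).aestronglyMeasurable
  · filter_upwards [ae_all_iff.2 hb] with ω hω
    rw [Real.norm_of_nonneg (Real.exp_pos _).le]
    apply Real.exp_le_exp.2
    calc s * ∑ i, g i ω ≤ |s * ∑ i, g i ω| := le_abs_self _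
      _ = |s| * |∑ i, g i ω| := abs_mul _ _
      _ ≤ |s| * ∑ _i : ι, b := by
        gcongr
        exact (Finset.abs_sum_le_sum_abs _ _).trans (Finset.sum_le_sum fun i _ => hω i)

/-- The exponential moment bound behind the Azuma–Hoeffding inequality. -/
theorem integral_exp_mul_sum_le {b : ℝ} (hb0 : 0 < b) (s : ℝ) :
    ∀ {T : ℕ} (ℱ : Fin T → MeasurableSpace Ω) (g : Fin T → Ω → ℝ), (∀ t, ℱ t ≤ mΩ) →
      (∀ t, Measurable (g t)) → (∀ t' t, t' < t → Measurable[ℱ t] (g t')) →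
      (∀ t, ∀ᵐ ω ∂P, |g t ω| ≤ b) → (∀ t, P[g t | ℱ t] =ᵐ[P] 0) →
      ∫ ω, Real.exp (s * ∑ t, g t ω) ∂P ≤ Real.exp (T * (s * b) ^ 2 / 2) := by
  intro T
  induction T with
  | zero => intro ℱ g _ _ _ _ _; simp
  | succ T ih =>
    intro ℱ g hℱ hg hgℱ hb h0
    have ih' := ih (fun t => ℱ t.castSucc) (fun t => g t.castSucc) (fun t => hℱ _)
      (fun t => hg _) (fun t' t h => hgℱ _ _ (by simpa using h)) (fun t => hb _) (fun t => h0 _)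
    set Y : Ω → ℝ := fun ω => Real.exp (s * ∑ t : Fin T, g t.castSucc ω) with hY
    set G : Ω → ℝ := g (Fin.last T) with hG
    have hYm : StronglyMeasurable[ℱ (Fin.last T)] Y := by
      have : ∀ t : Fin T, Measurable[ℱ (Fin.last T)] (g t.castSucc) :=
        fun t => hgℱ _ _ (Fin.castSucc_lt_last t)
      refine Measurable.stronglyMeasurable ?_
      fun_prop
    have hYi : Integrable Y P := integrable_exp_mul_sum s (fun t => hg _) (fun t => hb _)
    have hGi : Integrable G P := Integrable.of_bound (hg _).aestronglyMeasurable b (hb _)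
    have hYG : Integrable (fun ω => Y ω * G ω) P :=
      hYi.mul_bdd (c := b) (hg _).aestronglyMeasurable (hb _)
    have hzero := integral_mul_eq_zero_of_condExp_eq_zero (hℱ _) hYm hGi hYG (h0 _)
    -- By convexity, `exp (s x)` lies below its chord on `[-b, b]`. The chord is affine in the last
    -- increment, and its linear term integrates to zero against the past factor `Y`.
    have hle : ∀ᵐ ω ∂P, Real.exp (s * ∑ t, g t ω)
        ≤ Real.cosh (s * b) * Y ω + Real.sinh (s * b) / b * (Y ω * G ω) := by
      filter_upwards [hb (Fin.last T)] with ω hω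
      have h1 : |G ω / b| ≤ 1 := by
        rw [abs_div, abs_of_pos hb0, div_le_one hb0]
        exact hω
      have h2 := Real.exp_mul_le_cosh_add_mul_sinh h1 (s * b)
      have h3 : G ω / b * (s * b) = s * G ω := by field_simp
      rw [h3] at h2
      rw [Fin.sum_univ_castSucc, mul_add, Real.exp_add]
      calc Y ω * Real.exp (s * G ω)
          ≤ Y ω * (Real.cosh (s * b) + G ω / b * Real.sinh (s * b)) := by
            gcongr
        _ = _ := by ring
    calc ∫ ω, Real.exp (s * ∑ t, g t ω) ∂P
        ≤ ∫ ω, (Real.cosh (s * b) * Y ω + Real.sinh (s * b) / b * (Y ω * G ω)) ∂P :=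
          integral_mono_ae (integrable_exp_mul_sum s hg hb)
            ((hYi.const_mul _).add (hYG.const_mul _)) hle
      _ = Real.cosh (s * b) * ∫ ω, Y ω ∂P := by
          rw [integral_add (hYi.const_mul _) (hYG.const_mul _), integral_const_mul,
            integral_const_mul, hzero, mul_zero, add_zero]
      _ ≤ Real.exp ((s * b) ^ 2 / 2) * Real.exp (T * (s * b) ^ 2 / 2) := by
          gcongr
          exact Real.cosh_le_exp_half_sq _
      _ = _ := by
          rw [← Real.exp_add]
          congr 1
          push_cast
          ring

/-- The random variables `X i t` form, for every `i`, a martingale difference sequence, and these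
sequences are independent. -/
structure IsIndepMartingaleDiff {Ω : Type*} [mΩ : MeasurableSpace Ω] (P : Measure Ω) {ι : Type*}
    {T : ℕ} (mI : ι → MeasurableSpace Ω) (ℱ : ι → Fin T → MeasurableSpace Ω)
    (X : ι → Fin T → Ω → ℝ) : Prop where
  indep : iIndep mI P
  le : ∀ i, mI i ≤ mΩ
  filtration_le : ∀ i t, ℱ i t ≤ mI i
  mono : ∀ i t' t, t' ≤ t → ℱ i t' ≤ ℱ i t
  measurable : ∀ i t, Measurable[mI i] (X i t)
  adapted : ∀ i t' t, t' < t → Measurable[ℱ i t] (X i t')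
  condExp_eq_zero : ∀ i t, P[X i t | ℱ i t] =ᵐ[P] 0

namespace IsIndepMartingaleDiff

variable {ι : Type*} {T : ℕ} {mI : ι → MeasurableSpace Ω}
  {ℱ : ι → Fin T → MeasurableSpace Ω} {X : ι → Fin T → Ω → ℝ}

/-- Within one sequence the later term is centred given a σ-algebra that contains the earlier one;
across sequences, independence and zero means suffice. No joint filtration over all individuals is
needed. -/
lemma integral_mul_eq_zero (h : IsIndepMartingaleDiff P mI ℱ X) (h2 : ∀ i t, MemLp (X i t) 2 P)
    (r r' : ι × Fin T) (hr : r ≠ r') : ∫ ω, X r.1 r.2 ω * X r'.1 r'.2 ω ∂P = 0 := by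
  have key : ∀ i t' t, t' < t → ∫ ω, X i t' ω * X i t ω ∂P = 0 := fun i t' t htt =>
    integral_mul_eq_zero_of_condExp_eq_zero ((h.filtration_le i t).trans (h.le i))
      (h.adapted i t' t htt).stronglyMeasurable ((h2 i t).integrable (by norm_num))
      ((h2 i t').integrable_mul (h2 i t)) (h.condExp_eq_zero i t)
  obtain ⟨i, t⟩ := r
  obtain ⟨i', t'⟩ := r'
  by_cases hi : i = i'
  · subst hi
    rcases lt_trichotomy t t' with ht | ht | ht
    · exact key i t t' ht
    · exact absurd (by rw [ht]) hr
    · simp_rw [mul_comm (X i t _)]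
      exact key i t' t ht
  · have hind : X i t ⟂ᵢ[P] X i' t' :=
      indep_of_indep_of_le_left (indep_of_indep_of_le_right (h.indep.indep hi)
        (h.measurable i' t').comap_le) (h.measurable i t).comap_le
    have hz : ∫ ω, X i t ω ∂P = 0 := by
      rw [← integral_condExp ((h.filtration_le i t).trans (h.le i)),
        integral_congr_ae (h.condExp_eq_zero i t)]
      simp
    rw [hind.integral_fun_mul_eq_mul_integral (h2 i t).1 (h2 i' t').1, hz, zero_mul]

variable [Fintype ι]

/-- Chebyshev's inequality, with orthogonality making the second moment additive. It serves for the
truncation remainders, which are unbounded but small in `L²`. -/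
lemma measureReal_ge_le_div_sq (h : IsIndepMartingaleDiff P mI ℱ X)
    (h2 : ∀ i t, MemLp (X i t) 2 P) {V : ℝ} (hV : ∀ i t, ∫ ω, X i t ω ^ 2 ∂P ≤ V) {a : ℝ}
    (ha : 0 < a) :
    P.real {ω | a ≤ |∑ r : ι × Fin T, X r.1 r.2 ω|} ≤ Fintype.card ι * T * V / a ^ 2 := by
  have h1 := integral_sq_sum_eq (P := P) (H := fun r : ι × Fin T => X r.1 r.2)
    (fun r => h2 _ _) (fun r r' hr => h.integral_mul_eq_zero h2 r r' hr)
  have hint : Integrable (fun ω => (∑ r : ι × Fin T, X r.1 r.2 ω) ^ 2) P :=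
    (memLp_finsetSum _ fun (r : ι × Fin T) _ => h2 r.1 r.2).integrable_sq
  have h3 := mul_meas_ge_le_integral_of_nonneg (ae_of_all _ fun ω => sq_nonneg _) hint (a ^ 2)
  have hset : {ω | a ^ 2 ≤ (∑ r : ι × Fin T, X r.1 r.2 ω) ^ 2}
      = {ω | a ≤ |∑ r : ι × Fin T, X r.1 r.2 ω|} := by
    ext ω
    rw [Set.mem_ofPred_eq, Set.mem_ofPred_eq, sq_le_sq, abs_of_pos ha]
  rw [hset, h1] at h3
  rw [le_div_iff₀ (by positivity), mul_comm]
  refine h3.trans ((Finset.sum_le_sum fun r _ => hV r.1 r.2).trans (le_of_eq ?_))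
  simp

/-- The Azuma–Hoeffding inequality for independent sequences of bounded martingale differences. -/
lemma measureReal_ge_le_exp (h : IsIndepMartingaleDiff P mI ℱ X) {b : ℝ} (hb0 : 0 < b)
    (hb : ∀ i t, ∀ᵐ ω ∂P, |X i t ω| ≤ b) (hn : 0 < (Fintype.card ι : ℝ) * T) {a : ℝ}
    (ha : 0 ≤ a) :
    P.real {ω | a ≤ |∑ r : ι × Fin T, X r.1 r.2 ω|}
      ≤ 2 * Real.exp (-(a ^ 2 / (2 * (Fintype.card ι * T) * b ^ 2))) := by
  set n : ℝ := Fintype.card ι * T with hn'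
  have hXm : ∀ i t, Measurable (X i t) := fun i t => (h.measurable i t).mono (h.le i) le_rfl
  have hmgf : ∀ s : ℝ, mgf (fun ω => ∑ r : ι × Fin T, X r.1 r.2 ω) P s
      ≤ Real.exp (n * (s * b) ^ 2 / 2) := by
    intro s
    have hsum : (fun ω => ∑ r : ι × Fin T, X r.1 r.2 ω) = ∑ i, fun ω => ∑ t, X i t ω := by
      ext ω
      rw [Finset.sum_apply, Fintype.sum_prod_type]
    have hind : iIndepFun (fun i ω => ∑ t, X i t ω) P := by
      rw [iIndepFun_iff_iIndep]
      refine iIndep_of_iIndep_of_le h.indep fun i => Measurable.comap_le ?_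
      have := h.measurable i
      fun_prop
    rw [hsum, hind.mgf_sum (fun i => by have := hXm i; fun_prop)]
    calc _ ≤ ∏ _i : ι, Real.exp (T * (s * b) ^ 2 / 2) := by
          refine Finset.prod_le_prod (fun i _ => mgf_nonneg) fun i _ => ?_
          exact integral_exp_mul_sum_le hb0 s (ℱ i) (X i)
            (fun t => (h.filtration_le i t).trans (h.le i)) (hXm i) (h.adapted i) (hb i)
            (h.condExp_eq_zero i)
      _ = _ := by
          rw [Finset.prod_const, ← Real.exp_nat_mul, hn', Finset.card_univ]
          congr 1
          ring
  have hint : ∀ s : ℝ, Integrable (fun ω => Real.exp (s * ∑ r : ι × Fin T, X r.1 r.2 ω)) P :=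
    fun s => integrable_exp_mul_sum s (fun r => hXm _ _) (fun r => hb _ _)
  -- This is the minimiser of the Chernoff exponent `-s a + n s² b² / 2`.
  have hs : 0 ≤ a / (n * b ^ 2) := by positivity
  have hexp : ∀ s, s = a / (n * b ^ 2) →
      Real.exp (-(s * a)) * Real.exp (n * (s * b) ^ 2 / 2)
        = Real.exp (-(a ^ 2 / (2 * n * b ^ 2))) := by
    rintro s rfl
    rw [← Real.exp_add]
    congr 1
    field_simp
    ring
  have h1 := (measure_ge_le_exp_mul_mgf a hs (hint _)).trans
    (mul_le_mul_of_nonneg_left (hmgf _) (Real.exp_pos _).le)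
  have h2 := (measure_le_le_exp_mul_mgf (-a) (neg_nonpos.2 hs) (hint _)).trans
    (mul_le_mul_of_nonneg_left (hmgf _) (Real.exp_pos _).le)
  have e2 : -(-(a / (n * b ^ 2))) * -a = -(a / (n * b ^ 2) * a) := by ring
  have e3 : n * (-(a / (n * b ^ 2)) * b) ^ 2 / 2 = n * (a / (n * b ^ 2) * b) ^ 2 / 2 := by ring
  rw [neg_mul, hexp _ rfl] at h1
  rw [e2, e3, hexp _ rfl] at h2
  have hsub : {ω | a ≤ |∑ r : ι × Fin T, X r.1 r.2 ω|}
      ⊆ {ω | a ≤ ∑ r : ι × Fin T, X r.1 r.2 ω} ∪ {ω | ∑ r : ι × Fin T, X r.1 r.2 ω ≤ -a} := by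
    intro ω hω
    rcases le_abs.1 (show a ≤ |∑ r : ι × Fin T, X r.1 r.2 ω| from hω) with h | h
    · exact Or.inl h
    · exact Or.inr (show _ ≤ -a by linarith)
  refine (measureReal_mono hsub).trans ((measureReal_union_le _ _).trans ?_)
  linarith

/-- A deviation inequality for sums of independent sequences of martingale differences with
exponential moments. -/
theorem measureReal_sum_ge_le_of_one_le (h : IsIndepMartingaleDiff P mI ℱ X) {c K : ℝ}
    (hc : 0 < c) (hK : ∀ i t, ExpMomentLE P c K (X i t)) (hn : 0 < (Fintype.card ι : ℝ) * T)
    {u : ℝ} (hu : 1 ≤ u) :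
    P.real {ω | √(Fintype.card ι * T * u ^ 3) ≤ |∑ r : ι × Fin T, X r.1 r.2 ω|}
      ≤ 2 * Real.exp (-(u / 32)) + 32 * K / c ^ 2 * Real.exp (-(c * u / 2)) := by
  have hu0 : 0 < u := by linarith
  set n : ℝ := Fintype.card ι * T with hn'
  have hXm : ∀ i t, Measurable (X i t) := fun i t => (h.measurable i t).mono (h.le i) le_rfl
  have hX2 : ∀ i t, MemLp (X i t) 2 P :=
    fun i t => (hK i t).memLp_two hc (hXm i t).aestronglyMeasurable
  have hℱ : ∀ i t, ℱ i t ≤ mΩ := fun i t => (h.filtration_le i t).trans (h.le i)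
  have hg : IsIndepMartingaleDiff P mI ℱ (fun i t => truncDiff (ℱ i t) P u (X i t)) :=
    { indep := h.indep
      le := h.le
      filtration_le := h.filtration_le
      mono := h.mono
      measurable := fun i t => measurable_truncDiff (h.measurable i t) (h.filtration_le i t)
      adapted := fun i t' t ht =>
        measurable_truncDiff (h.adapted i t' t ht) (h.mono i t' t ht.le)
      condExp_eq_zero := fun i t => condExp_truncDiff (hℱ i t) hu0.le (hXm i t) }
  have hH : IsIndepMartingaleDiff P mI ℱ
      (fun i t ω => X i t ω - truncDiff (ℱ i t) P u (X i t) ω) :=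
    { indep := h.indep
      le := h.le
      filtration_le := h.filtration_le
      mono := h.mono
      measurable := fun i t => (h.measurable i t).sub (hg.measurable i t)
      adapted := fun i t' t ht => (h.adapted i t' t ht).sub (hg.adapted i t' t ht)
      condExp_eq_zero := fun i t => condExp_sub_truncDiff (hXm i t)
        ((hX2 i t).integrable (by norm_num)) (hℱ i t) hu0.le (h.condExp_eq_zero i t) }
  -- Half of the threshold goes to each part. The truncated differences are bounded by `2u`, so
  -- Azuma–Hoeffding has exponent `a² / (8 n u²) = u/32`, linear in `u` like the exponent of the
  -- truncation error.
  set a : ℝ := √(n * u ^ 3) / 2 with ha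
  have ha0 : 0 < a := by positivity
  have ha2 : a ^ 2 = n * u ^ 3 / 4 := by
    rw [ha, div_pow, Real.sq_sqrt (by positivity)]
    norm_num
  have h1 := hg.measureReal_ge_le_exp (b := 2 * u) (by linarith)
    (fun i t => abs_truncDiff_le hu0.le _) hn ha0.le
  have h2 := hH.measureReal_ge_le_div_sq
    (fun i t => (hX2 i t).sub (memLp_truncDiff (hℱ i t) hu0.le (hXm i t)))
    (fun i t => (hK i t).integral_sq_sub_truncDiff_le hc (hXm i t) (hℱ i t) hu0.le
      (h.condExp_eq_zero i t)) ha0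
  rw [← hn', ha2] at h1 h2
  have e1 : n * u ^ 3 / 4 / (2 * n * (2 * u) ^ 2) = u / 32 := by
    field_simp
    norm_num
  rw [e1] at h1
  have hK0 : 0 ≤ K := by
    by_contra hneg
    have hne : Nonempty (ι × Fin T) := by
      rw [← Fintype.card_pos_iff, Fintype.card_prod, Fintype.card_fin]
      have hn2 : 0 < (Fintype.card ι : ℝ) * T := hn
      exact_mod_cast hn2
    exact hneg (hK hne.some.1 hne.some.2).nonneg
  have e2 : n * (8 / c ^ 2 * Real.exp (-(c * u / 2)) * K) / (n * u ^ 3 / 4)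
      ≤ 32 * K / c ^ 2 * Real.exp (-(c * u / 2)) := by
    have : n * (8 / c ^ 2 * Real.exp (-(c * u / 2)) * K) / (n * u ^ 3 / 4)
        = 32 * K / c ^ 2 * Real.exp (-(c * u / 2)) / u ^ 3 := by
      field_simp
      ring
    rw [this]
    exact div_le_self (by positivity) (one_le_pow₀ hu)
  have hsub : {ω | √(n * u ^ 3) ≤ |∑ r : ι × Fin T, X r.1 r.2 ω|}
      ⊆ {ω | a ≤ |∑ r : ι × Fin T, truncDiff (ℱ r.1 r.2) P u (X r.1 r.2) ω|}
        ∪ {ω | a ≤ |∑ r : ι × Fin T,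
            (X r.1 r.2 ω - truncDiff (ℱ r.1 r.2) P u (X r.1 r.2) ω)|} := by
    intro ω hω
    by_contra hcon
    simp only [Set.mem_union, Set.mem_ofPred_eq, not_or, not_le] at hcon hω
    have h3 := abs_add_le (∑ r : ι × Fin T, truncDiff (ℱ r.1 r.2) P u (X r.1 r.2) ω)
      (∑ r : ι × Fin T, (X r.1 r.2 ω - truncDiff (ℱ r.1 r.2) P u (X r.1 r.2) ω))
    rw [← Finset.sum_add_distrib] at h3
    simp only [add_sub_cancel] at h3
    linarith [hcon.1, hcon.2]
  refine (measureReal_mono hsub).trans ((measureReal_union_le _ _).trans ?_)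
  exact add_le_add h1 (h2.trans e2)

/-- For `u < 1` the right-hand side already exceeds one, because `B ≤ 1/32`; this removes the
restriction on `u`. -/
theorem measureReal_sum_ge_le (h : IsIndepMartingaleDiff P mI ℱ X) {c K : ℝ}
    (hc : 0 < c) (hK : ∀ i t, ExpMomentLE P c K (X i t)) (hn : 0 < (Fintype.card ι : ℝ) * T)
    {u B : ℝ} (hu : 0 ≤ u) (hB : B ≤ 1 / 32) (hBc : B ≤ c / 2) (hK0 : 0 ≤ K) :
    P.real {ω | √(Fintype.card ι * T * u ^ 3) ≤ |∑ r : ι × Fin T, X r.1 r.2 ω|}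
      ≤ (3 + 32 * K / c ^ 2) * Real.exp (-(B * u)) := by
  have hA0 : 0 ≤ 32 * K / c ^ 2 := by positivity
  rcases le_or_gt 1 u with h1 | h1
  · refine (h.measureReal_sum_ge_le_of_one_le hc hK hn h1).trans ?_
    have e1 : Real.exp (-(u / 32)) ≤ Real.exp (-(B * u)) := by
      apply Real.exp_le_exp.2
      nlinarith
    have e2 : Real.exp (-(c * u / 2)) ≤ Real.exp (-(B * u)) := by
      apply Real.exp_le_exp.2
      nlinarith
    have e3 := mul_le_mul_of_nonneg_left e2 hA0
    linarith [Real.exp_pos (-(B * u))]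
  · refine measureReal_le_one.trans ?_
    have e1 := Real.add_one_le_exp (-(B * u))
    nlinarith [mul_nonneg hA0 (Real.exp_pos (-(B * u))).le]

end IsIndepMartingaleDiff

end MartingaleDifferences

/-! ### The deterministic oracle inequality. -/

section Deterministic

/-- The elementary inequality that turns a basic inequality and an eigenvalue bound into a rate. -/
lemma rate_of_basic_inequality {n Q lam D a b s κ m q Qpop : ℝ} (hn : 0 < n) (hlam : 0 < lam)
    (hκ : 0 < κ) (hs : 0 < s) (hb : 0 ≤ b) (hQ : 0 ≤ Q) (hD : 0 ≤ D) (ha : 0 ≤ a)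
    (hbasic : n * Q + lam * D ≤ 4 * lam * a + 4 * lam * b) (hq : a ^ 2 ≤ s * q)
    (hpop : κ * q ≤ Qpop) (hdev : Qpop - m * D ^ 2 ≤ Q) (hm0 : 0 ≤ m) (hm : 256 * m * s ≤ κ) :
    Q ≤ 120 * lam ^ 2 * s / (κ * n ^ 2) + 20 * (lam * b / n) ∧
      D ≤ 120 * lam * s / (κ * n) + 20 * b := by
  have hlD : 0 ≤ lam * D := by positivity
  have hnQ : 0 ≤ n * Q := by positivity
  -- Either the error on the active set dominates and the eigenvalue bound is needed, or the
  -- approximation error `b` dominates and the basic inequality alone suffices.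
  rcases le_or_gt b a with hab | hab
  · have h8 : n * Q + lam * D ≤ 8 * lam * a := by nlinarith
    have hDa : D ≤ 8 * a := by
      have : lam * D ≤ lam * (8 * a) := by linarith
      exact le_of_mul_le_mul_left this hlam
    have hD2 : D ^ 2 ≤ 64 * a ^ 2 := by nlinarith
    have h1 : κ * a ^ 2 ≤ s * (Q + 64 * m * a ^ 2) := by
      calc κ * a ^ 2 ≤ κ * (s * q) := by gcongr
        _ = s * (κ * q) := by ring
        _ ≤ s * (Q + 64 * m * a ^ 2) := by
          gcongr
          have := mul_le_mul_of_nonneg_left hD2 hm0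
          linarith
    -- As `D ≤ 8a`, the Gram deviation costs at most `64 m s a² ≤ κ a² / 4`, which is absorbed on
    -- the left. This is the origin of `256 = 4 · 64`.
    have h2 : 3 * (κ * a ^ 2) ≤ 4 * (s * Q) := by
      have := mul_le_mul_of_nonneg_right hm (sq_nonneg a)
      nlinarith
    constructor
    · have h3 : Q ≤ 120 * lam ^ 2 * s / (κ * n ^ 2) := by
        rw [le_div_iff₀ (by positivity)]
        rcases hQ.eq_or_lt with h0 | h0
        · rw [← h0, zero_mul]
          positivity
        · have h4 : (n * Q) ^ 2 ≤ (8 * lam * a) ^ 2 := by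
            apply pow_le_pow_left₀ hnQ
            linarith
          have h5 : κ * (n * Q) ^ 2 ≤ 64 * lam ^ 2 * (κ * a ^ 2) := by nlinarith
          have h6 : Q * (Q * (κ * n ^ 2)) ≤ Q * (120 * lam ^ 2 * s) := by
            have := mul_le_mul_of_nonneg_left h2 (sq_nonneg lam)
            have h7 : 0 ≤ lam ^ 2 * (s * Q) := by positivity
            nlinarith
          exact le_of_mul_le_mul_left h6 h0
      have : 0 ≤ 20 * (lam * b / n) := by positivity
      linarith
    · have h3 : D ≤ 120 * lam * s / (κ * n) := by
        rw [le_div_iff₀ (by positivity)]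
        have h4 : lam * D ≤ 8 * lam * a - n * Q := by linarith
        have h5 : s * κ * n * (8 * lam * a - n * Q)
            ≤ s * κ * n * (8 * lam * a) - n ^ 2 * κ * (3 / 4 * (κ * a ^ 2)) := by
          have : 0 ≤ n ^ 2 * κ := by positivity
          nlinarith
        -- Completing the square in `n κ a`, with maximum at `3 n κ a = 16 lam s`. The resulting
        -- constant `64/3` is well below `120`.
        have h6 : s * κ * n * (8 * lam * a) - n ^ 2 * κ * (3 / 4 * (κ * a ^ 2))
            ≤ 64 / 3 * (lam * s) ^ 2 := by
          nlinarith [sq_nonneg (3 * n * κ * a - 16 * lam * s)]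
        have h7 : s * κ * n * (lam * D) ≤ 64 / 3 * (lam * s) ^ 2 :=
          (mul_le_mul_of_nonneg_left h4 (by positivity)).trans (h5.trans h6)
        have h8 : (s * lam) * (D * (κ * n)) ≤ (s * lam) * (120 * lam * s) := by
          nlinarith [sq_nonneg (lam * s)]
        exact le_of_mul_le_mul_left h8 (by positivity)
      linarith
  · have h8 : n * Q + lam * D ≤ 8 * lam * b := by nlinarith
    have hlb : 0 ≤ lam * b := by positivity
    constructor
    · have h3 : Q ≤ 20 * (lam * b / n) := by
        rw [mul_div_assoc', le_div_iff₀ hn]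
        linarith
      have : 0 ≤ 120 * lam ^ 2 * s / (κ * n ^ 2) := by positivity
      linarith
    · have h3 : D ≤ 20 * b := by
        have : lam * D ≤ lam * (20 * b) := by linarith
        exact le_of_mul_le_mul_left this hlam
      have : 0 ≤ 120 * lam * s / (κ * n) := by positivity
      linarith

lemma abs_sum_mul_le {ι : Type*} [Fintype ι] {f g : ι → ℝ} {B : ℝ} (h : ∀ i, |f i| ≤ B) :
    |∑ i, f i * g i| ≤ B * l1Norm g := by
  rw [l1Norm, Finset.mul_sum]
  refine (Finset.abs_sum_le_sum_abs _ _).trans (Finset.sum_le_sum fun i _ => ?_)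
  rw [abs_mul]
  gcongr
  exact h i

lemma l1Norm_nonneg {ι : Type*} [Fintype ι] (f : ι → ℝ) : 0 ≤ l1Norm f :=
  Finset.sum_nonneg fun _ _ => abs_nonneg _

lemma sqNorm_nonneg {ι : Type*} [Fintype ι] (f : ι → ℝ) : 0 ≤ sqNorm f :=
  Finset.sum_nonneg fun _ _ => sq_nonneg _

lemma abs_sum_sum_mul_le {ι κ : Type*} [Fintype ι] [Fintype κ] {G : ι → κ → ℝ} {f : ι → ℝ}
    {g : κ → ℝ} {B : ℝ} (h : ∀ i j, |G i j| ≤ B) :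
    |∑ i, ∑ j, f i * g j * G i j| ≤ B * (l1Norm f * l1Norm g) := by
  have h1 : ∀ i, |∑ j, G i j * g j| ≤ B * l1Norm g := fun i => abs_sum_mul_le (h i)
  have h2 := abs_sum_mul_le (g := f) h1
  have h3 : ∑ i, ∑ j, f i * g j * G i j = ∑ i, (∑ j, G i j * g j) * f i := by
    refine Finset.sum_congr rfl fun i _ => ?_
    rw [Finset.sum_mul]
    exact Finset.sum_congr rfl fun j _ => by ring
  rw [h3]
  linarith

/-- The `ℓ₁` part of the basic inequality, for an arbitrary index set `J`. -/
lemma l1Norm_sub_add_le {ι : Type*} [Fintype ι] [DecidableEq ι] (J : Finset ι) (a b : ι → ℝ) :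
    l1Norm (a - b) + l1Norm b - l1Norm a
      ≤ 2 * ∑ j ∈ J, |(a - b) j| + 2 * ∑ j ∈ Jᶜ, |b j| := by
  simp only [l1Norm]
  rw [← Finset.sum_add_distrib, ← Finset.sum_sub_distrib, ← Finset.sum_add_sum_compl J,
    Finset.mul_sum, Finset.mul_sum]
  refine add_le_add (Finset.sum_le_sum fun j _ => ?_) (Finset.sum_le_sum fun j _ => ?_)
  · have := abs_sub_abs_le_abs_sub (b j) (a j)
    rw [abs_sub_comm] at this
    simp only [Pi.sub_apply]
    linarith
  · have := abs_sub (a j) (b j)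
    simp only [Pi.sub_apply]
    linarith

variable {Ω : Type*} [MeasurableSpace Ω] {N T L px : ℕ}

lemma design_mulVec_apply (d : PanelData Ω N T L px) (ω : Ω) (u : Fin L ⊕ Fin px → ℝ)
    (v : Fin N → ℝ) (r : Fin N × Fin T) :
    (d.design ω *ᵥ Sum.elim u v) r = (∑ j, d.z r.1 r.2 ω j * u j) + v r.1 := by
  rw [PanelData.design, Matrix.fromCols_mulVec_sumElim]
  simp [Matrix.mulVec, dotProduct, PanelData.Z, PanelData.dummies]

lemma Y_eq (d : PanelData Ω N T L px) {α : Fin L ⊕ Fin px → ℝ} {η : Fin N → ℝ}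
    (h : d.SatisfiesModel α η) (ω : Ω) (r : Fin N × Fin T) :
    d.Y ω r = (d.design ω *ᵥ Sum.elim α η) r + d.ε r.1 r.2 ω := by
  rw [design_mulVec_apply]
  exact h r.1 r.2 ω

lemma sqNorm_sub {ι : Type*} [Fintype ι] (e w : ι → ℝ) :
    sqNorm (e - w) = sqNorm e - 2 * ∑ r, e r * w r + sqNorm w := by
  simp only [sqNorm, Finset.mul_sum, ← Finset.sum_add_distrib, ← Finset.sum_sub_distrib]
  refine Finset.sum_congr rfl fun r _ => ?_
  simp only [Pi.sub_apply]
  ring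

/-- The basic inequality of the panel Lasso. -/
lemma IsPanelLasso.basic_inequality {d : PanelData Ω N T L px} {α : Fin L ⊕ Fin px → ℝ}
    {η : Fin N → ℝ} (hmodel : d.SatisfiesModel α η) {lam : ℝ} (hlam : 0 ≤ lam) {ω : Ω}
    {a : Fin L ⊕ Fin px → ℝ} {h : Fin N → ℝ} (hL : IsPanelLasso d lam ω a h)
    (hZ : ∀ j, |∑ r : Fin N × Fin T, d.z r.1 r.2 ω j * d.ε r.1 r.2 ω| ≤ lam / 2)
    (hD : ∀ i, |∑ t, d.ε i t ω| ≤ lam / √N / 2)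
    (J₁ : Finset (Fin L ⊕ Fin px)) (J₂ : Finset (Fin N)) :
    sqNorm (d.design ω *ᵥ (Sum.elim a h - Sum.elim α η)) + lam * l1Norm (a - α)
        + lam / √N * l1Norm (h - η)
      ≤ 4 * lam * (∑ j ∈ J₁, |(a - α) j| + ∑ j ∈ J₁ᶜ, |α j|)
        + 4 * (lam / √N) * (∑ j ∈ J₂, |(h - η) j| + ∑ j ∈ J₂ᶜ, |η j|) := by
  set e : Fin N × Fin T → ℝ := fun r => d.ε r.1 r.2 ω with he
  set w := d.design ω *ᵥ (Sum.elim a h - Sum.elim α η) with hw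
  have hsub : Sum.elim a h - Sum.elim α η = Sum.elim (a - α) (h - η) := by
    ext (j | j) <;> simp
  have h1 : d.Y ω - d.design ω *ᵥ Sum.elim a h = e - w := by
    ext r
    rw [hw, Matrix.mulVec_sub]
    simp only [Pi.sub_apply, Y_eq d hmodel ω r, he]
    ring
  have h2 : d.Y ω - d.design ω *ᵥ Sum.elim α η = e := by
    ext r
    simp only [Pi.sub_apply, Y_eq d hmodel ω r, he]
    ring
  have h3 := hL α η
  rw [lassoObjective, lassoObjective, h1, h2, sqNorm_sub] at h3
  have hcross : ∑ r, e r * w r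
      = ∑ j, (∑ r : Fin N × Fin T, d.z r.1 r.2 ω j * d.ε r.1 r.2 ω) * (a - α) j
        + ∑ i, (∑ t, d.ε i t ω) * (h - η) i := by
    have : ∀ r, e r * w r = ∑ j, d.z r.1 r.2 ω j * d.ε r.1 r.2 ω * (a - α) j
        + d.ε r.1 r.2 ω * (h - η) r.1 := by
      intro r
      rw [hw, hsub, design_mulVec_apply, mul_add, Finset.mul_sum]
      congr 1
      exact Finset.sum_congr rfl fun j _ => by simp only [he]; ring
    simp_rw [this, Finset.sum_add_distrib, Finset.sum_mul]
    congr 1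
    · exact Finset.sum_comm
    · rw [Fintype.sum_prod_type]
  have h4 := le_abs_self (∑ j, (∑ r : Fin N × Fin T, d.z r.1 r.2 ω j * d.ε r.1 r.2 ω) * (a - α) j)
  have h5 := le_abs_self (∑ i, (∑ t, d.ε i t ω) * (h - η) i)
  have h6 := abs_sum_mul_le (g := a - α) hZ
  have h7 := abs_sum_mul_le (g := h - η) hD
  -- The noise uses up one copy of the weighted ℓ₁ error. Adding another copy to both sides produces
  -- the combination bounded by `l1Norm_sub_add_le`.
  have hμ : 0 ≤ lam / √N := by positivity
  have h8 := mul_le_mul_of_nonneg_left (l1Norm_sub_add_le J₁ a α) hlam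
  have h9 := mul_le_mul_of_nonneg_left (l1Norm_sub_add_le J₂ h η) hμ
  linarith

/-- The dummy block of the Gram matrix is exactly `T · I`, so only two blocks deviate. The `Z` block
is compared with `Ψ`, the cross block with zero: after division by `T √N` its entries are small
without any centring. Adding `m (‖v‖₁/√N)²` completes the square. -/
lemma sqNorm_design_mulVec_ge (d : PanelData Ω N T L px) (ω : Ω) (hN : 1 ≤ N) (hT : 1 ≤ T)
    (Ψ : Matrix (Fin L ⊕ Fin px) (Fin L ⊕ Fin px) ℝ) {m : ℝ} (hm0 : 0 ≤ m)
    (hΨ : ∀ j k, |1 / ((N : ℝ) * T) * ∑ r : Fin N × Fin T, d.z r.1 r.2 ω j * d.z r.1 r.2 ω k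
      - Ψ j k| ≤ m)
    (hZD : ∀ j i, |∑ t, d.z i t ω j| ≤ m * (T * √N))
    (u : Fin L ⊕ Fin px → ℝ) (v : Fin N → ℝ) :
    u ⬝ᵥ (Ψ *ᵥ u) + 1 / N * ∑ i, v i ^ 2 - m * (l1Norm u + l1Norm v / √N) ^ 2
      ≤ 1 / ((N : ℝ) * T) * sqNorm (d.design ω *ᵥ Sum.elim u v) := by
  have hN0 : (0 : ℝ) < N := by exact_mod_cast hN
  have hT0 : (0 : ℝ) < T := by exact_mod_cast hT
  set G : Fin L ⊕ Fin px → Fin L ⊕ Fin px → ℝ := fun j k =>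
    1 / ((N : ℝ) * T) * ∑ r : Fin N × Fin T, d.z r.1 r.2 ω j * d.z r.1 r.2 ω k with hG
  have hexp : sqNorm (d.design ω *ᵥ Sum.elim u v)
      = ∑ j, ∑ k, u j * u k * (∑ r : Fin N × Fin T, d.z r.1 r.2 ω j * d.z r.1 r.2 ω k)
        + 2 * (∑ j, ∑ i, u j * v i * ∑ t, d.z i t ω j) + T * ∑ i, v i ^ 2 := by
    have e1 : ∀ r : Fin N × Fin T, (d.design ω *ᵥ Sum.elim u v) r ^ 2
        = ∑ j, ∑ k, u j * u k * (d.z r.1 r.2 ω j * d.z r.1 r.2 ω k)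
          + 2 * ∑ j, u j * v r.1 * d.z r.1 r.2 ω j + v r.1 ^ 2 := by
      intro r
      rw [design_mulVec_apply, add_sq, pow_two (∑ j, _), Finset.sum_mul_sum, mul_assoc,
        Finset.sum_mul]
      congr 2
      · exact Finset.sum_congr rfl fun j _ => Finset.sum_congr rfl fun k _ => by ring
      · congr 1
        exact Finset.sum_congr rfl fun j _ => by ring
    simp only [sqNorm, e1, Finset.sum_add_distrib, ← Finset.mul_sum]
    congr 2
    · rw [Finset.sum_comm]
      refine Finset.sum_congr rfl fun j _ => ?_
      rw [Finset.sum_comm]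
      exact Finset.sum_congr rfl fun k _ => by rw [Finset.mul_sum]
    · rw [Finset.sum_comm]
      congr 1
      refine Finset.sum_congr rfl fun j _ => ?_
      rw [Fintype.sum_prod_type]
      exact Finset.sum_congr rfl fun i _ => by rw [Finset.mul_sum]
    · rw [Fintype.sum_prod_type]
      simp [Finset.mul_sum]
  have hquad : u ⬝ᵥ (Ψ *ᵥ u) = ∑ j, ∑ k, u j * u k * Ψ j k := by
    simp only [dotProduct, Matrix.mulVec, Finset.mul_sum]
    exact Finset.sum_congr rfl fun j _ => Finset.sum_congr rfl fun k _ => by ring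
  have hGsum : 1 / ((N : ℝ) * T) *
      ∑ j, ∑ k, u j * u k * (∑ r : Fin N × Fin T, d.z r.1 r.2 ω j * d.z r.1 r.2 ω k)
      = u ⬝ᵥ (Ψ *ᵥ u) + ∑ j, ∑ k, u j * u k * (G j k - Ψ j k) := by
    rw [hquad, ← Finset.sum_add_distrib, Finset.mul_sum]
    refine Finset.sum_congr rfl fun j _ => ?_
    rw [← Finset.sum_add_distrib, Finset.mul_sum]
    exact Finset.sum_congr rfl fun k _ => by simp only [hG]; ring
  have h1 := neg_abs_le (∑ j, ∑ k, u j * u k * (G j k - Ψ j k))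
  have h2 := abs_sum_sum_mul_le (f := u) (g := u) hΨ
  have h3 := neg_abs_le (∑ j, ∑ i, u j * v i * ∑ t, d.z i t ω j)
  have h4 := abs_sum_sum_mul_le (f := u) (g := v) hZD
  have hsq : (√N : ℝ) * √N = N := Real.mul_self_sqrt hN0.le
  have hs0 : 0 < √(N : ℝ) := Real.sqrt_pos.2 hN0
  have h5 : -(m * (l1Norm u * (l1Norm v / √N)))
      ≤ 1 / ((N : ℝ) * T) * ∑ j, ∑ i, u j * v i * ∑ t, d.z i t ω j := by
    rw [one_div_mul_eq_div, le_div_iff₀ (by positivity)]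
    have : -(m * (l1Norm u * (l1Norm v / √N))) * (N * T)
        = -(m * (T * √N) * (l1Norm u * l1Norm v)) := by
      field_simp
      rw [Real.sq_sqrt hN0.le]
    linarith
  have h6 : 1 / ((N : ℝ) * T) * (T * ∑ i, v i ^ 2) = 1 / N * ∑ i, v i ^ 2 := by
    field_simp
  rw [hexp, mul_add, mul_add, hGsum, h6]
  have h7 : 0 ≤ m * (l1Norm v / √N) ^ 2 := by positivity
  nlinarith

/-- The restricted eigenvalue bound encoded by `kappaSq`. -/
lemma kappaSq_mul_sum_sq_le {ι : Type*} [Fintype ι] {Ψ : Matrix ι ι ℝ} {s : ℕ} (hs : 1 ≤ s)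
    (hκ : 0 < kappaSq Ψ s) (R : Finset ι) (hR : R.card ≤ s) (δ : ι → ℝ) :
    kappaSq Ψ s * ∑ j ∈ R, δ j ^ 2 ≤ δ ⬝ᵥ (Ψ *ᵥ δ) := by
  have main : ∀ R : Finset ι, R.card ≤ s → 0 < ∑ j ∈ R, δ j ^ 2 →
      kappaSq Ψ s * ∑ j ∈ R, δ j ^ 2 ≤ δ ⬝ᵥ (Ψ *ᵥ δ) := by
    intro R hR hpos
    rw [← le_div_iff₀ hpos]
    refine (min_le_right _ _).trans (csInf_le ?_ ⟨R, δ, hR, hpos, rfl⟩)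
    -- A set unbounded below has real infimum `0` by default, which contradicts `0 < kappaSq Ψ s`.
    by_contra hbdd
    have h0 := Real.sInf_of_not_bddBelow hbdd
    have h1 : kappaSq Ψ s ≤ 0 := (min_le_right _ _).trans h0.le
    linarith
  rcases (Finset.sum_nonneg fun j (_ : j ∈ R) => sq_nonneg (δ j)).eq_or_lt with h0 | h0
  · rw [← h0, mul_zero]
    -- The definition says nothing about `R` when `δ` vanishes on it. A singleton in the support of
    -- `δ`, admissible since `1 ≤ s`, still shows that the quadratic form is nonnegative.
    by_cases hδ : ∃ j, δ j ≠ 0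
    · obtain ⟨j, hj⟩ := hδ
      have hpos : 0 < ∑ k ∈ {j}, δ k ^ 2 := by
        rw [Finset.sum_singleton]
        positivity
      exact (by positivity : 0 ≤ kappaSq Ψ s * ∑ k ∈ {j}, δ k ^ 2).trans
        (main {j} (by simpa using hs) hpos)
    · push Not at hδ
      have : δ = 0 := funext hδ
      simp [this]
  · exact main R hR h0

lemma rpow_mul_rpow_one_sub {x ν : ℝ} (hx : 0 < x) : x ^ ν * x ^ (1 - ν) = x := by
  rw [← Real.rpow_add hx]
  simp

/-- Cauchy–Schwarz over two blocks: `(ab)² ≤ (tp)(sq)` and the arithmetic–geometric mean inequality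
bound the cross term. It merges the sparsity of the two parameter blocks. -/
lemma add_sq_le_mul_add {a b s t p q : ℝ} (hs : 0 < s) (ht : 0 < t) (ha : a ^ 2 ≤ s * p)
    (hb : b ^ 2 ≤ t * q) : (a + b) ^ 2 ≤ (s + t) * (p + q) := by
  have hp : 0 ≤ p := nonneg_of_mul_nonneg_right ((sq_nonneg a).trans ha) hs
  have hq : 0 ≤ q := nonneg_of_mul_nonneg_right ((sq_nonneg b).trans hb) ht
  have h1 : (2 * (a * b)) ^ 2 ≤ (t * p + s * q) ^ 2 := by
    have h2 := mul_le_mul ha hb (sq_nonneg b) (by positivity)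
    nlinarith [sq_nonneg (t * p - s * q)]
  have h3 := abs_le_of_sq_le_sq' h1 (by positivity)
  nlinarith [h3.2]

/-- In a weakly sparse vector, few entries exceed a given level, and the others are summably
small. -/
lemma card_and_sum_of_sum_rpow_le {ι : Type*} [Fintype ι] [DecidableEq ι] {η : ι → ℝ} {ν E Ξ : ℝ}
    (hν : 0 ≤ ν) (hν1 : ν < 1) (hΞ : 0 < Ξ) (h : ∑ i with η i ≠ 0, |η i| ^ ν ≤ E) :
    ((Finset.univ.filter fun i => Ξ < |η i|).card : ℝ) ≤ E * Ξ ^ (-ν) ∧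
      ∑ i ∈ (Finset.univ.filter fun i => Ξ < |η i|)ᶜ, |η i| ≤ E * Ξ ^ (1 - ν) := by
  constructor
  · rw [Real.rpow_neg hΞ.le, ← div_eq_mul_inv, le_div_iff₀ (by positivity), ← nsmul_eq_mul,
      ← Finset.sum_const]
    refine le_trans ?_ h
    refine (Finset.sum_le_sum (g := fun i => |η i| ^ ν) fun i hi => ?_).trans
      (Finset.sum_le_sum_of_subset_of_nonneg ?_ fun i _ _ => by positivity)
    · rw [Finset.mem_filter] at hi
      exact Real.rpow_le_rpow hΞ.le hi.2.le hν
    · intro i hi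
      rw [Finset.mem_filter] at hi ⊢
      refine ⟨hi.1, fun h0 => ?_⟩
      rw [h0, abs_zero] at hi
      linarith [hi.2]
  · have h1 : ∀ i ∈ (Finset.univ.filter fun i => Ξ < |η i|)ᶜ,
        |η i| ≤ if η i ≠ 0 then |η i| ^ ν * Ξ ^ (1 - ν) else 0 := by
      intro i hi
      simp only [Finset.mem_compl, Finset.mem_filter, Finset.mem_univ, true_and, not_lt] at hi
      split_ifs with h0
      · have hp : 0 < |η i| := abs_pos.2 h0
        calc |η i| = |η i| ^ ν * |η i| ^ (1 - ν) := (rpow_mul_rpow_one_sub hp).symm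
          _ ≤ _ := by
            gcongr
      · push Not at h0
        simp [h0]
    refine (Finset.sum_le_sum h1).trans ((Finset.sum_le_sum_of_subset_of_nonneg
      (Finset.subset_univ _) fun i _ _ => ?_).trans ?_)
    · split_ifs <;> positivity
    · rw [← Finset.sum_filter, ← Finset.sum_mul]
      gcongr

/-- The oracle inequalities hold at every sample point at which the noise and the deviation of the
Gram matrix from its population counterpart are under control. -/
theorem oracle_inequalities_of_controlled {d : PanelData Ω N T L px} {α : Fin L ⊕ Fin px → ℝ}
    {η : Fin N → ℝ} (hN : 1 ≤ N) (hT : 1 ≤ T) (hmodel : d.SatisfiesModel α η) {s₁ : ℕ}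
    (hs₁ : 1 ≤ s₁) {ν E lam Ξ m : ℝ} (hν : 0 ≤ ν) (hν1 : ν < 1) (hlam : 0 < lam) (hE : 0 < E)
    (hΞ : Ξ = lam / (√N * T)) (hsparse : (α, η) ∈ sparseClass N s₁ ν E)
    {Ψ : Matrix (Fin L ⊕ Fin px) (Fin L ⊕ Fin px) ℝ} {κ : ℝ} (hκ : κ = kappaSq Ψ s₁) (hκ0 : 0 < κ)
    (hm0 : 0 ≤ m) (hm : 256 * m * (s₁ + E * Ξ ^ (-ν)) ≤ κ) {ω : Ω}
    (hZ : ∀ j, |∑ r : Fin N × Fin T, d.z r.1 r.2 ω j * d.ε r.1 r.2 ω| ≤ lam / 2)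
    (hD : ∀ i, |∑ t, d.ε i t ω| ≤ lam / √N / 2)
    (hΨ : ∀ j k, |1 / ((N : ℝ) * T) * ∑ r : Fin N × Fin T, d.z r.1 r.2 ω j * d.z r.1 r.2 ω k
      - Ψ j k| ≤ m)
    (hZD : ∀ j i, |∑ t, d.z i t ω j| ≤ m * (T * √N))
    {a : Fin L ⊕ Fin px → ℝ} {h : Fin N → ℝ} (hL : IsPanelLasso d lam ω a h) :
    1 / ((N : ℝ) * T) * sqNorm (d.design ω *ᵥ (Sum.elim a h - Sum.elim α η))
        ≤ 120 * lam ^ 2 * s₁ / (κ * ((N : ℝ) * T) ^ 2)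
          + (120 / κ + 20) * (lam / (√N * N * T)) * E * Ξ ^ (1 - ν) ∧
    l1Norm (a - α) ≤ 120 * lam * s₁ / (κ * N * T) + (120 / κ + 20) * (1 / √N) * E * Ξ ^ (1 - ν) ∧
    l1Norm (h - η) ≤ 120 * lam * s₁ / (κ * √N * T) + (120 / κ + 20) * E * Ξ ^ (1 - ν) := by
  have hN0 : (0 : ℝ) < N := by exact_mod_cast hN
  have hT0 : (0 : ℝ) < T := by exact_mod_cast hT
  have hsN : 0 < √(N : ℝ) := Real.sqrt_pos.2 hN0
  have hsq : √(N : ℝ) * √N = N := Real.mul_self_sqrt hN0.le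
  have hΞ0 : 0 < Ξ := by rw [hΞ]; positivity
  have hsub : Sum.elim a h - Sum.elim α η = Sum.elim (a - α) (h - η) := by
    ext (j | j) <;> simp
  set J₁ : Finset (Fin L ⊕ Fin px) := Finset.univ.filter fun j => α j ≠ 0 with hJ₁
  set J₂ : Finset (Fin N) := Finset.univ.filter fun i => Ξ < |η i| with hJ₂
  have hJ₁card : J₁.card ≤ s₁ := by
    refine le_trans (le_of_eq ?_) hsparse.1
    rw [l0Norm, ← Set.ncard_coe_finset]
    congr 1
    ext j
    simp [hJ₁]
  have hJ₁c : ∑ j ∈ J₁ᶜ, |α j| = 0 :=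
    Finset.sum_eq_zero fun j hj => by simpa [hJ₁] using hj
  obtain ⟨hJ₂card, hJ₂c⟩ := card_and_sum_of_sum_rpow_le hν hν1 hΞ0 hsparse.2
  rw [← hJ₂] at hJ₂card hJ₂c
  have hbasic := hL.basic_inequality hmodel hlam.le hZ hD J₁ J₂
  rw [hJ₁c, add_zero, hsub] at hbasic
  have hdev := sqNorm_design_mulVec_ge d ω hN hT Ψ hm0 hΨ hZD (a - α) (h - η)
  have hRE := kappaSq_mul_sum_sq_le hs₁ (hκ ▸ hκ0) J₁ hJ₁card (a - α)
  rw [← hκ] at hRE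
  have hκ1 : κ ≤ 1 := hκ ▸ min_le_left _ _
  set Q := 1 / ((N : ℝ) * T) * sqNorm (d.design ω *ᵥ Sum.elim (a - α) (h - η)) with hQ
  set U := l1Norm (a - α) with hU
  set V := l1Norm (h - η) with hV
  set s₂ : ℝ := E * Ξ ^ (-ν) with hs₂
  have hs₂0 : 0 < s₂ := by positivity
  have hs₁0 : (0 : ℝ) < s₁ := by exact_mod_cast hs₁
  have hU0 : 0 ≤ U := l1Norm_nonneg _
  have hV0 : 0 ≤ V := l1Norm_nonneg _
  have hQ0 : 0 ≤ Q := mul_nonneg (by positivity) (sqNorm_nonneg _)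
  have hnQ : ((N : ℝ) * T) * Q = sqNorm (d.design ω *ᵥ Sum.elim (a - α) (h - η)) := by
    rw [hQ]
    field_simp
  set b : ℝ := E * Ξ ^ (1 - ν) / √N with hb
  set S₁ := ∑ j ∈ J₁, |(a - α) j| with hS₁
  set S₂ := ∑ i ∈ J₂, |(h - η) i| with hS₂
  set q₁ := ∑ j ∈ J₁, (a - α) j ^ 2 with hq₁
  set q₂ := ∑ i ∈ J₂, (h - η) i ^ 2 with hq₂
  have hc₁ : S₁ ^ 2 ≤ s₁ * q₁ := by
    have h1 := sq_sum_le_card_mul_sum_sq (s := J₁) (f := fun j => |(a - α) j|)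
    simp only [sq_abs] at h1
    refine h1.trans ?_
    gcongr
  have hc₂ : S₂ ^ 2 ≤ s₂ * q₂ := by
    have h1 := sq_sum_le_card_mul_sum_sq (s := J₂) (f := fun j => |(h - η) j|)
    simp only [sq_abs] at h1
    refine h1.trans ?_
    gcongr
  have hq₁0 : 0 ≤ q₁ := Finset.sum_nonneg fun _ _ => sq_nonneg _
  have hq₂0 : 0 ≤ q₂ := Finset.sum_nonneg fun _ _ => sq_nonneg _
  have hS₁0 : 0 ≤ S₁ := Finset.sum_nonneg fun _ _ => abs_nonneg _
  have hS₂0 : 0 ≤ S₂ := Finset.sum_nonneg fun _ _ => abs_nonneg _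
  have hq : (S₁ + S₂ / √N) ^ 2 ≤ (s₁ + s₂) * (q₁ + q₂ / N) := by
    have e1 : (S₂ / √N) ^ 2 ≤ s₂ * (q₂ / N) := by
      rw [div_pow, Real.sq_sqrt hN0.le, mul_div_assoc']
      gcongr
    exact add_sq_le_mul_add hs₁0 hs₂0 hc₁ e1
  have hpop : κ * (q₁ + q₂ / N) ≤ (a - α) ⬝ᵥ (Ψ *ᵥ (a - α)) + 1 / N * ∑ i, (h - η) i ^ 2 := by
    -- The dummy block has eigenvalue one in scaled coordinates; the truncation of `kappaSq` at `1`
    -- lets the same `κ` serve both blocks.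
    have e1 : κ * (q₂ / N) ≤ 1 / N * ∑ i, (h - η) i ^ 2 := by
      calc κ * (q₂ / N) ≤ 1 * (q₂ / N) := by gcongr
        _ = 1 / N * q₂ := by ring
        _ ≤ _ := by
          gcongr
          exact Finset.sum_le_univ_sum_of_nonneg fun i => sq_nonneg _
    rw [mul_add]
    exact add_le_add hRE e1
  have hb2 : (∑ i ∈ J₂ᶜ, |η i|) / √N ≤ b := div_le_div_of_nonneg_right hJ₂c hsN.le
  have hbasic' : (N : ℝ) * T * Q + lam * (U + V / √N)
      ≤ 4 * lam * (S₁ + S₂ / √N) + 4 * lam * b := by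
    rw [hnQ]
    have e1 := mul_le_mul_of_nonneg_left hb2 (by positivity : 0 ≤ 4 * lam)
    have e2 : lam / √N * V = lam * (V / √N) := by ring
    have e3 : 4 * (lam / √N) * (S₂ + ∑ i ∈ J₂ᶜ, |η i|)
        = 4 * lam * (S₂ / √N) + 4 * lam * ((∑ i ∈ J₂ᶜ, |η i|) / √N) := by ring
    rw [e2, e3] at hbasic
    linarith
  obtain ⟨hr1, hr2⟩ := rate_of_basic_inequality (n := (N : ℝ) * T) (by positivity) hlam hκ0
    (by positivity) (by positivity) hQ0 (by positivity) (by positivity) hbasic' hq hpop hdev hm0 hm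
  have hΞs : s₂ * Ξ = E * Ξ ^ (1 - ν) := by
    rw [hs₂, mul_assoc]
    congr 1
    conv_lhs => rw [← Real.rpow_one Ξ, ← Real.rpow_mul hΞ0.le, one_mul, ← Real.rpow_add hΞ0]
    congr 1
    ring
  -- The level `Ξ` is chosen to equate the cost of estimating the large effects with the error of
  -- ignoring the small ones. Both therefore merge into the factor `120 / κ + 20`.
  have hs₂eq : lam * s₂ / (N * T) = b := by
    rw [hb, ← hΞs, hΞ]
    field_simp
    rw [Real.sq_sqrt hN0.le]
  have key : 120 * lam * (s₁ + s₂) / (κ * (N * T)) + 20 * b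
      = 120 * lam * s₁ / (κ * N * T) + (120 / κ + 20) * (1 / √N) * E * Ξ ^ (1 - ν) := by
    have e1 : 120 * lam * (s₁ + s₂) / (κ * (N * T))
        = 120 * lam * s₁ / (κ * N * T) + 120 / κ * (lam * s₂ / (N * T)) := by
      field_simp
    rw [e1, hs₂eq, hb]
    ring
  rw [key] at hr2
  refine ⟨?_, ?_, ?_⟩
  · rw [hsub]
    refine hr1.trans (le_of_eq ?_)
    have e1 : 120 * lam ^ 2 * (s₁ + s₂) / (κ * (N * T) ^ 2)
        = 120 * lam ^ 2 * s₁ / (κ * (N * T) ^ 2)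
          + 120 / κ * (lam / (N * T)) * (lam * s₂ / (N * T)) := by
      field_simp
    rw [e1, hs₂eq, hb]
    field_simp
    ring
  · have : 0 ≤ V / √N := by positivity
    linarith
  · have e1 : V / √N ≤ 120 * lam * s₁ / (κ * N * T) + (120 / κ + 20) * (1 / √N) * E * Ξ ^ (1 - ν) := by
      linarith
    rw [div_le_iff₀ hsN] at e1
    refine e1.trans (le_of_eq ?_)
    field_simp
    linear_combination (120 * lam * s₁) * hsq

end Deterministic

/-! ### From subgaussian tails to exponential moments. -/

section SubgaussianMoments

variable {Ω : Type*} [MeasurableSpace Ω] {P : Measure Ω} {X Y : Ω → ℝ}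

/-- A bound for `E exp (C X² / 2)` under the tail bound `P (|X| ≥ u) ≤ K / 2 exp (- C u²)`. -/
noncomputable def sqExpBound (C K : ℝ) : ℝ :=
  Real.exp (C / 2) * (1 / 2 * K) * (1 - Real.exp (-(C / 2)))⁻¹

lemma exp_neg_half_lt_one {C : ℝ} (hC : 0 < C) : Real.exp (-(C / 2)) < 1 := by
  rw [← Real.exp_zero]
  exact Real.exp_lt_exp.2 (by linarith)

lemma sqExpBound_pos {C K : ℝ} (hC : 0 < C) (hK : 0 < K) : 0 < sqExpBound C K := by
  have := exp_neg_half_lt_one hC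
  have h2 : 0 < 1 - Real.exp (-(C / 2)) := by linarith
  unfold sqExpBound
  positivity

/-- A discrete layer-cake bound: the single term `n = ⌊x²⌋` already dominates. -/
lemma exp_sq_le_tsum {C : ℝ} (hC : 0 < C) (x : ℝ) :
    ENNReal.ofReal (Real.exp (C / 2 * x ^ 2))
      ≤ ∑' n : ℕ, {y : ℝ | √n ≤ |y|}.indicator
          (fun _ => ENNReal.ofReal (Real.exp (C / 2 * (n + 1)))) x := by
  refine le_trans ?_ (ENNReal.le_tsum ⌊x ^ 2⌋₊)
  rw [Set.indicator_of_mem]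
  · apply ENNReal.ofReal_le_ofReal
    apply Real.exp_le_exp.2
    have := (Nat.lt_floor_add_one (x ^ 2)).le
    gcongr
  · have h1 : (⌊x ^ 2⌋₊ : ℝ) ≤ x ^ 2 := Nat.floor_le (sq_nonneg x)
    calc √(⌊x ^ 2⌋₊ : ℝ) ≤ √(x ^ 2) := Real.sqrt_le_sqrt h1
      _ = |x| := Real.sqrt_sq_eq_abs x

/-- Taking half of the tail rate leaves a factor `exp (-C n / 2)` at level `√n`, so the layers sum
to a geometric series. -/
lemma lintegral_exp_sq_le [IsProbabilityMeasure P] {C K : ℝ} (hC : 0 < C) (hK : 0 < K)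
    (hX : Measurable X)
    (h : ∀ u : ℝ, 0 ≤ u → P.real {ω | u ≤ |X ω|} ≤ 1 / 2 * K * Real.exp (-C * u ^ 2)) :
    ∫⁻ ω, ENNReal.ofReal (Real.exp (C / 2 * X ω ^ 2)) ∂P
      ≤ ENNReal.ofReal (sqExpBound C K) := by
  have hms : ∀ n : ℕ, MeasurableSet {ω | √(n : ℝ) ≤ |X ω|} := fun n =>
    measurableSet_le measurable_const (by fun_prop)
  have hind : ∀ (n : ℕ) ω, {y : ℝ | √n ≤ |y|}.indicator
      (fun _ => ENNReal.ofReal (Real.exp (C / 2 * (n + 1)))) (X ω)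
      = {ω | √n ≤ |X ω|}.indicator
        (fun _ => ENNReal.ofReal (Real.exp (C / 2 * (n + 1)))) ω := fun n ω => by
    simp [Set.indicator]
  calc _ ≤ ∫⁻ ω, ∑' n : ℕ, {ω | √n ≤ |X ω|}.indicator
          (fun _ => ENNReal.ofReal (Real.exp (C / 2 * (n + 1)))) ω ∂P := by
        refine lintegral_mono fun ω => ?_
        have := exp_sq_le_tsum hC (X ω)
        simp_rw [hind] at this
        exact this
    _ = ∑' n : ℕ, ENNReal.ofReal (Real.exp (C / 2 * (n + 1))) * P {ω | √n ≤ |X ω|} := by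
        rw [lintegral_tsum fun n => (measurable_const.indicator (hms n)).aemeasurable]
        simp_rw [lintegral_indicator_const (hms _)]
    _ ≤ ∑' n : ℕ, ENNReal.ofReal
          (Real.exp (C / 2) * (1 / 2 * K) * Real.exp (-(C / 2)) ^ n) := by
        refine ENNReal.tsum_le_tsum fun n => ?_
        rw [← ofReal_measureReal, ← ENNReal.ofReal_mul (Real.exp_pos _).le]
        apply ENNReal.ofReal_le_ofReal
        have h1 := h (√n) (Real.sqrt_nonneg _)
        rw [Real.sq_sqrt (Nat.cast_nonneg n)] at h1
        calc _ ≤ Real.exp (C / 2 * (n + 1)) * (1 / 2 * K * Real.exp (-C * n)) := by gcongr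
          _ = 1 / 2 * K * (Real.exp (C / 2 * (n + 1)) * Real.exp (-C * n)) := by ring
          _ = 1 / 2 * K * (Real.exp (C / 2) * Real.exp (n * (-(C / 2)))) := by
            rw [← Real.exp_add, ← Real.exp_add]
            congr 2
            ring
          _ = _ := by
            rw [Real.exp_nat_mul]
            ring
    _ = ENNReal.ofReal (sqExpBound C K) := by
        have hlt := exp_neg_half_lt_one hC
        have hs := (hasSum_geometric_of_lt_one (Real.exp_pos (-(C / 2))).le hlt).mul_left
          (Real.exp (C / 2) * (1 / 2 * K))
        rw [← ENNReal.ofReal_tsum_of_nonneg (fun n => by positivity) hs.summable, hs.tsum_eq]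
        rfl

lemma integrable_exp_sq [IsProbabilityMeasure P] {C K : ℝ} (hC : 0 < C) (hK : 0 < K)
    (hX : Measurable X)
    (h : ∀ u : ℝ, 0 ≤ u → P.real {ω | u ≤ |X ω|} ≤ 1 / 2 * K * Real.exp (-C * u ^ 2)) :
    Integrable (fun ω => Real.exp (C / 2 * X ω ^ 2)) P ∧
      ∫ ω, Real.exp (C / 2 * X ω ^ 2) ∂P ≤ sqExpBound C K := by
  have h1 := lintegral_exp_sq_le hC hK hX h
  have hm : Measurable fun ω => Real.exp (C / 2 * X ω ^ 2) := by fun_prop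
  constructor
  · refine ⟨hm.aestronglyMeasurable, ?_⟩
    rw [hasFiniteIntegral_iff_ofReal (ae_of_all _ fun ω => (Real.exp_pos _).le)]
    exact h1.trans_lt ENNReal.ofReal_lt_top
  · rw [integral_eq_lintegral_of_nonneg_ae (ae_of_all _ fun ω => (Real.exp_pos _).le)
      hm.aestronglyMeasurable]
    exact ENNReal.toReal_le_of_le_ofReal (sqExpBound_pos hC hK).le h1

/-- From `|XY| ≤ (X² + Y²)/2` and convexity of the exponential; neither the order `c` nor the bound
`K` deteriorates. -/
lemma expMomentLE_mul {c K : ℝ} (hc : 0 < c) (hX : Measurable X) (hY : Measurable Y)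
    (h1 : Integrable (fun ω => Real.exp (c * X ω ^ 2)) P ∧
      ∫ ω, Real.exp (c * X ω ^ 2) ∂P ≤ K)
    (h2 : Integrable (fun ω => Real.exp (c * Y ω ^ 2)) P ∧
      ∫ ω, Real.exp (c * Y ω ^ 2) ∂P ≤ K) :
    ExpMomentLE P c K (fun ω => X ω * Y ω) := by
  have hle : ∀ ω, Real.exp (c * |X ω * Y ω|)
      ≤ 1 / 2 * (Real.exp (c * X ω ^ 2) + Real.exp (c * Y ω ^ 2)) := by
    intro ω
    have h3 : c * |X ω * Y ω| ≤ c * X ω ^ 2 / 2 + c * Y ω ^ 2 / 2 := by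
      rw [abs_mul]
      nlinarith [mul_nonneg hc.le (sq_nonneg (|X ω| - |Y ω|)), sq_abs (X ω), sq_abs (Y ω)]
    have h4 := Real.exp_le_exp.2 h3
    have e : ∀ x : ℝ, Real.exp x = Real.exp (x / 2) ^ 2 := fun x => by
      rw [← Real.exp_nat_mul]
      congr 1
      push_cast
      ring
    rw [Real.exp_add] at h4
    rw [e (c * X ω ^ 2), e (c * Y ω ^ 2)]
    nlinarith [sq_nonneg (Real.exp (c * X ω ^ 2 / 2) - Real.exp (c * Y ω ^ 2 / 2))]
  have := ExpMomentLE.of_le_const_mul (K := 2 * K) (h1.1.add h2.1) (X := fun ω => X ω * Y ω)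
    (c' := c) (A := 1 / 2) ?_ (by norm_num) (hX.mul hY).aestronglyMeasurable hle
  · simpa using this
  · have e := integral_add h1.1 h2.1
    simp only [Pi.add_apply]
    rw [e]
    linarith [h1.2, h2.2]

lemma expMomentLE_of_exp_sq {c K : ℝ} (hc : 0 < c) (hX : Measurable X)
    (h1 : Integrable (fun ω => Real.exp (c * X ω ^ 2)) P ∧
      ∫ ω, Real.exp (c * X ω ^ 2) ∂P ≤ K) :
    ExpMomentLE P c (Real.exp c * K) X := by
  refine ExpMomentLE.of_le_const_mul h1.1 h1.2 (Real.exp_pos _).le hX.aestronglyMeasurable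
    fun ω => ?_
  rw [← Real.exp_add]
  apply Real.exp_le_exp.2
  have : |X ω| ≤ 1 + X ω ^ 2 := by
    rw [← sq_abs]
    nlinarith [sq_nonneg (|X ω| - 1)]
  nlinarith

/-- Jensen's inequality. The bound is free of `T` and holds under any dependence over time. -/
lemma expMomentLE_average {T : ℕ} (hT : 1 ≤ T) {c K : ℝ} (hc : 0 < c) {W : Fin T → Ω → ℝ}
    (hm : ∀ t, Measurable (W t)) (h : ∀ t, ExpMomentLE P c K (W t)) :
    ExpMomentLE P c K (fun ω => 1 / (T : ℝ) * ∑ t, W t ω) := by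
  have hT0 : (0 : ℝ) < T := by exact_mod_cast hT
  have hle : ∀ ω, Real.exp (c * |1 / (T : ℝ) * ∑ t, W t ω|)
      ≤ 1 / (T : ℝ) * ∑ t, Real.exp (c * |W t ω|) := by
    intro ω
    have hJ := convexOn_exp.map_sum_le (t := Finset.univ) (w := fun _ : Fin T => 1 / (T : ℝ))
      (p := fun t => c * |W t ω|) (fun _ _ => by positivity)
      (by simp [hT0.ne']) (fun _ _ => Set.mem_univ _)
    simp only [smul_eq_mul, ← Finset.mul_sum] at hJ
    refine le_trans (Real.exp_le_exp.2 ?_) hJ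
    rw [abs_mul, abs_of_pos (by positivity : 0 < 1 / (T : ℝ))]
    have := Finset.abs_sum_le_sum_abs (fun t => W t ω) Finset.univ
    calc c * (1 / T * |∑ t, W t ω|) ≤ c * (1 / T * ∑ t, |W t ω|) := by gcongr
      _ = _ := by ring
  have := ExpMomentLE.of_le_const_mul (K := T * K) (P := P)
    (integrable_finsetSum Finset.univ fun t _ => (h t).1)
    (X := fun ω => 1 / (T : ℝ) * ∑ t, W t ω) (c' := c) (A := 1 / T) ?_ (by positivity)
    (by fun_prop : Measurable fun ω => 1 / (T : ℝ) * ∑ t, W t ω).aestronglyMeasurable hle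
  · have e : 1 / (T : ℝ) * (T * K) = K := by field_simp
    rwa [e] at this
  · rw [integral_finsetSum _ fun t _ => (h t).1]
    refine (Finset.sum_le_sum fun t _ => (h t).2).trans ?_
    simp

lemma ExpMomentLE.sub_integral [IsProbabilityMeasure P] {c K : ℝ} (hc : 0 < c) (hX : Measurable X)
    (h : ExpMomentLE P c K X) :
    ExpMomentLE P c (Real.exp K * K) (fun ω => X ω - ∫ ω', X ω' ∂P) := by
  have hi : Integrable X P := (h.memLp_two hc hX.aestronglyMeasurable).integrable (by norm_num)
  have h1 : c * |∫ ω', X ω' ∂P| ≤ K := by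
    calc c * |∫ ω', X ω' ∂P| ≤ c * ∫ ω', |X ω'| ∂P := by
          gcongr
          exact abs_integral_le_integral_abs
      _ = ∫ ω', c * |X ω'| ∂P := (integral_const_mul _ _).symm
      _ ≤ ∫ ω', Real.exp (c * |X ω'|) ∂P := by
          refine integral_mono (hi.abs.const_mul c) h.1 fun ω => ?_
          have := Real.add_one_le_exp (c * |X ω|)
          simp only
          linarith
      _ ≤ K := h.2
  refine ExpMomentLE.of_le_const_mul h.1 h.2 (Real.exp_pos _).le
    (hX.sub measurable_const).aestronglyMeasurable fun ω => ?_
  rw [← Real.exp_add]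
  apply Real.exp_le_exp.2
  have := abs_sub (X ω) (∫ ω', X ω' ∂P)
  nlinarith

end SubgaussianMoments

/-! ### Measurability with respect to individual blocks and pasts. -/

namespace PanelData

variable {Ω : Type*} [mΩ : MeasurableSpace Ω] {N T L px : ℕ} {d : PanelData Ω N T L px}

/-- The σ-algebra is left free to cover the ambient one, the blocks and the pasts. The index `t`
means time `t + 1`, so the lags reach up to time `t`. -/
lemma measurable_z_of {Ω : Type*} {m : MeasurableSpace Ω} [MeasurableSpace Ω] {N T L px : ℕ}
    {d : PanelData Ω N T L px} {i : Fin N} {t : Fin T}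
    (hy : ∀ s : ℤ, 1 - (L : ℤ) ≤ s → s ≤ t → Measurable[m] (d.y i s))
    (hx : Measurable[m] (d.x i t)) (j : Fin L ⊕ Fin px) :
    Measurable[m] (fun ω => d.z i t ω j) := by
  rcases j with l | k
  · exact hy _ (by have := l.2; omega) (by omega)
  · exact (measurable_pi_apply k).comp hx

lemma measurable_z (d : PanelData Ω N T L px) (i : Fin N) (t : Fin T) (j : Fin L ⊕ Fin px) :
    Measurable (fun ω => d.z i t ω j) :=
  measurable_z_of (fun s h1 h2 => d.measurable_y i s h1 (by have := t.2; omega))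
    (d.measurable_x i t) j

lemma measurable_block (d : PanelData Ω N T L px) (i : Fin N) : Measurable (d.block i) := by
  unfold block
  refine Measurable.prodMk ?_ (Measurable.prodMk ?_ ?_)
  · exact measurable_pi_lambda _ fun l => d.measurable_y i _ (by have := l.2; omega) (by omega)
  · exact measurable_pi_lambda _ fun t => d.measurable_x i t
  · exact measurable_pi_lambda _ fun t => d.measurable_ε i t

/-- The σ-algebra generated by the variables of individual `i`. -/
@[reducible] def blockSigma (d : PanelData Ω N T L px) (i : Fin N) : MeasurableSpace Ω :=
  MeasurableSpace.comap (d.block i) inferInstance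

lemma blockSigma_le (d : PanelData Ω N T L px) (i : Fin N) : d.blockSigma i ≤ mΩ :=
  (d.measurable_block i).comap_le

lemma measurable_x_blockSigma (i : Fin N) (t : Fin T) : Measurable[d.blockSigma i] (d.x i t) :=
  ((measurable_pi_apply t).comp (measurable_fst.comp measurable_snd)).comp
    (comap_measurable (d.block i))

lemma measurable_ε_blockSigma (i : Fin N) (t : Fin T) : Measurable[d.blockSigma i] (d.ε i t) :=
  ((measurable_pi_apply t).comp (measurable_snd.comp measurable_snd)).comp
    (comap_measurable (d.block i))

/-- The model equation is solved forward from the initial observations, so independence of the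
blocks carries over to the responses. -/
lemma measurable_y_blockSigma {α : Fin L ⊕ Fin px → ℝ} {η : Fin N → ℝ}
    (h : d.SatisfiesModel α η) (i : Fin N) (n : ℕ) :
    ∀ s : ℤ, 1 - (L : ℤ) ≤ s → s ≤ n → s ≤ T → Measurable[d.blockSigma i] (d.y i s) := by
  induction n with
  | zero =>
    intro s h1 h2 _
    have hl : (-s).toNat < L := by omega
    have e : s = -(((⟨(-s).toNat, hl⟩ : Fin L) : ℕ) : ℤ) := by push_cast; omega
    rw [e]
    exact ((measurable_pi_apply (⟨(-s).toNat, hl⟩ : Fin L)).comp measurable_fst).comp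
      (comap_measurable (d.block i))
  | succ n ih =>
    intro s h1 h2 h3
    rcases le_or_gt s n with hs | hs
    · exact ih s h1 hs h3
    · have hn : n < T := by omega
      have e : s = (((⟨n, hn⟩ : Fin T) : ℕ) : ℤ) + 1 := by push_cast at h2 ⊢; omega
      have hz : ∀ j, Measurable[d.blockSigma i] (fun ω => d.z i ⟨n, hn⟩ ω j) :=
        measurable_z_of (fun s' h1 h2 => ih s' h1 h2 (by simp only at h2; omega))
          (measurable_x_blockSigma i _)
      have hε := measurable_ε_blockSigma (d := d) i ⟨n, hn⟩
      have hy : d.y i s = fun ω => d.z i ⟨n, hn⟩ ω ⬝ᵥ α + η i + d.ε i ⟨n, hn⟩ ω := by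
        rw [e]
        exact funext fun ω => h i ⟨n, hn⟩ ω
      rw [hy]
      simp only [dotProduct]
      fun_prop

lemma measurable_z_blockSigma {α : Fin L ⊕ Fin px → ℝ} {η : Fin N → ℝ}
    (h : d.SatisfiesModel α η) (i : Fin N) (t : Fin T) (j : Fin L ⊕ Fin px) :
    Measurable[d.blockSigma i] (fun ω => d.z i t ω j) :=
  measurable_z_of (fun s h1 h2 => measurable_y_blockSigma h i T s h1
    (by have := t.2; omega) (by have := t.2; omega)) (measurable_x_blockSigma i t) j

lemma past_le_blockSigma {α : Fin L ⊕ Fin px → ℝ} {η : Fin N → ℝ}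
    (h : d.SatisfiesModel α η) (i : Fin N) (t : Fin T) : d.past i t ≤ d.blockSigma i := by
  refine sup_le (iSup_le fun s => ?_) (iSup_le fun t' => ?_)
  · have := t.2
    have h2 := s.2.2
    exact (measurable_y_blockSigma h i T s s.2.1 (by omega) (by omega)).comap_le
  · exact (measurable_x_blockSigma i t'.1).comap_le

lemma measurable_y_past {i : Fin N} {t : Fin T} {s : ℤ} (h1 : 1 - (L : ℤ) ≤ s) (h2 : s ≤ t) :
    Measurable[d.past i t] (d.y i s) := by
  rw [measurable_iff_comap_le]
  exact le_sup_of_le_left (le_iSup (fun s : {s : ℤ // 1 - (L : ℤ) ≤ s ∧ s ≤ ((t : ℤ) + 1) - 1} =>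
    MeasurableSpace.comap (d.y i s) inferInstance) ⟨s, h1, by omega⟩)

lemma measurable_x_past {i : Fin N} {t' t : Fin T} (h : t' ≤ t) :
    Measurable[d.past i t] (d.x i t') := by
  rw [measurable_iff_comap_le]
  exact le_sup_of_le_right (le_iSup (fun t' : {t' : Fin T // t' ≤ t} =>
    MeasurableSpace.comap (d.x i t') inferInstance) ⟨t', h⟩)

lemma measurable_z_past {i : Fin N} {t' t : Fin T} (h : t' ≤ t) (j : Fin L ⊕ Fin px) :
    Measurable[d.past i t] (fun ω => d.z i t' ω j) :=
  measurable_z_of (fun _ h1 h2 => measurable_y_past h1 (by have : (t' : ℕ) ≤ t := h; omega))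
    (measurable_x_past h) j

/-- Errors do not generate the past, but an earlier error is recovered from it as the residual of
the model equation. -/
lemma measurable_ε_past {α : Fin L ⊕ Fin px → ℝ} {η : Fin N → ℝ} (hmodel : d.SatisfiesModel α η)
    {i : Fin N} {t' t : Fin T} (h : t' < t) : Measurable[d.past i t] (d.ε i t') := by
  have hlt : (t' : ℕ) < t := h
  have hy : Measurable[d.past i t] (d.y i ((t' : ℤ) + 1)) :=
    measurable_y_past (by omega) (by omega)
  have hz := fun j => measurable_z_past (d := d) (i := i) h.le j
  have e : d.ε i t' = fun ω => d.y i ((t' : ℤ) + 1) ω - d.z i t' ω ⬝ᵥ α - η i := by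
    ext ω
    rw [hmodel i t' ω]
    ring
  rw [e]
  simp only [dotProduct]
  fun_prop

lemma past_mono (d : PanelData Ω N T L px) (i : Fin N) {t' t : Fin T} (h : t' ≤ t) :
    d.past i t' ≤ d.past i t := by
  have hlt : (t' : ℕ) ≤ t := h
  refine sup_le (iSup_le fun s => ?_) (iSup_le fun t'' => ?_)
  · have := s.2.2
    exact (measurable_y_past s.2.1 (by omega)).comap_le
  · exact (measurable_x_past (t''.2.trans h)).comap_le

end PanelData

lemma rpow_one_third_pow_three {x : ℝ} (hx : 0 ≤ x) : (x ^ (1 / 3 : ℝ)) ^ 3 = x := by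
  rw [← Real.rpow_natCast, ← Real.rpow_mul hx]
  norm_num

/-! ### Deviation bounds for the noise and the Gram matrix. -/

namespace PanelData

variable {Ω : Type*} [mΩ : MeasurableSpace Ω] {P : Measure Ω} [IsProbabilityMeasure P]
  {N T L px : ℕ} {d : PanelData Ω N T L px} {C K : ℝ}

/-- A common bound for the exponential moments of order `C / 2` of the errors, of the regressors,
of their products and of the centred products of regressors. -/
noncomputable def momentBound (C K : ℝ) : ℝ :=
  (1 + Real.exp (C / 2) + Real.exp (sqExpBound C K)) * sqExpBound C K

/-- The multiplicative constant in the deviation inequalities. -/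
noncomputable def deviationConst (C K : ℝ) : ℝ := 3 + 32 * momentBound C K / (C / 2) ^ 2

/-- The rate in the deviation inequalities. -/
noncomputable def deviationRate (C : ℝ) : ℝ := min (1 / 32) (C / 2 / 2)

lemma momentBound_pos (hC : 0 < C) (hK : 0 < K) : 0 < momentBound C K :=
  mul_pos (by positivity) (sqExpBound_pos hC hK)

lemma deviationConst_pos (hC : 0 < C) (hK : 0 < K) : 0 < deviationConst C K := by
  have := momentBound_pos hC hK
  unfold deviationConst
  positivity

lemma deviationRate_pos (hC : 0 < C) : 0 < deviationRate C :=
  lt_min (by norm_num) (by positivity)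

lemma expMomentLE_ε (hC : 0 < C) (hK : 0 < K) (h : d.Subgaussian P C K)
    (i : Fin N) (t : Fin T) :
    ExpMomentLE P (C / 2) (momentBound C K) (d.ε i t) := by
  have hc : 0 < C / 2 := by positivity
  have hb := sqExpBound_pos hC hK
  refine (expMomentLE_of_exp_sq hc (d.measurable_ε i t)
    (integrable_exp_sq hC hK (d.measurable_ε i t) (h.1 i t))).mono le_rfl ?_
    (d.measurable_ε i t).aestronglyMeasurable
  unfold momentBound
  gcongr
  linarith [Real.exp_pos (sqExpBound C K)]

lemma expMomentLE_z (hC : 0 < C) (hK : 0 < K) (h : d.Subgaussian P C K)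
    (i : Fin N) (t : Fin T) (j : Fin L ⊕ Fin px) :
    ExpMomentLE P (C / 2) (momentBound C K) (fun ω => d.z i t ω j) := by
  have hc : 0 < C / 2 := by positivity
  have hb := sqExpBound_pos hC hK
  refine (expMomentLE_of_exp_sq hc (d.measurable_z i t j)
    (integrable_exp_sq hC hK (d.measurable_z i t j) (h.2 i t j))).mono le_rfl ?_
    (d.measurable_z i t j).aestronglyMeasurable
  unfold momentBound
  gcongr
  linarith [Real.exp_pos (sqExpBound C K)]

lemma expMomentLE_z_mul_ε (hC : 0 < C) (hK : 0 < K) (h : d.Subgaussian P C K)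
    (i : Fin N) (t : Fin T) (j : Fin L ⊕ Fin px) :
    ExpMomentLE P (C / 2) (momentBound C K) (fun ω => d.z i t ω j * d.ε i t ω) := by
  have hc : 0 < C / 2 := by positivity
  have hb := sqExpBound_pos hC hK
  refine (expMomentLE_mul hc (d.measurable_z i t j) (d.measurable_ε i t)
    (integrable_exp_sq hC hK (d.measurable_z i t j) (h.2 i t j))
    (integrable_exp_sq hC hK (d.measurable_ε i t) (h.1 i t))).mono le_rfl ?_
    ((d.measurable_z i t j).mul (d.measurable_ε i t)).aestronglyMeasurable
  unfold momentBound
  refine le_mul_of_one_le_left hb.le ?_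
  linarith [Real.exp_pos (sqExpBound C K), Real.exp_pos (C / 2)]

lemma expMomentLE_z_mul_z (hC : 0 < C) (hK : 0 < K) (h : d.Subgaussian P C K)
    (i : Fin N) (t : Fin T) (j k : Fin L ⊕ Fin px) :
    ExpMomentLE P (C / 2) (sqExpBound C K) (fun ω => d.z i t ω j * d.z i t ω k) :=
  expMomentLE_mul (by positivity) (d.measurable_z i t j) (d.measurable_z i t k)
    (integrable_exp_sq hC hK (d.measurable_z i t j) (h.2 i t j))
    (integrable_exp_sq hC hK (d.measurable_z i t k) (h.2 i t k))

section Deviations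

variable {α : Fin L ⊕ Fin px → ℝ} {η : Fin N → ℝ}

lemma isIndepMartingaleDiff_z_mul_ε (hC : 0 < C) (hK : 0 < K) (h : d.Subgaussian P C K)
    (hmodel : d.SatisfiesModel α η) (hind : d.IndepExogenous P) (j : Fin L ⊕ Fin px) :
    IsIndepMartingaleDiff P d.blockSigma d.past (fun i t ω => d.z i t ω j * d.ε i t ω) where
  indep := hind.1
  le := d.blockSigma_le
  filtration_le := past_le_blockSigma hmodel
  mono i _ _ ht := d.past_mono i ht
  measurable i t := (measurable_z_blockSigma hmodel i t j).mul (measurable_ε_blockSigma i t)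
  adapted _ _ _ ht := (measurable_z_past ht.le j).mul (measurable_ε_past hmodel ht)
  condExp_eq_zero i t := by
    have hc : 0 < C / 2 := by positivity
    have h1 := ((expMomentLE_z_mul_ε hC hK h i t j).memLp_two hc
      ((d.measurable_z i t j).mul (d.measurable_ε i t)).aestronglyMeasurable).integrable
      (by norm_num)
    have h2 := ((expMomentLE_ε hC hK h i t).memLp_two hc
      (d.measurable_ε i t).aestronglyMeasurable).integrable (by norm_num)
    have h3 : P[fun ω => d.z i t ω j * d.ε i t ω | d.past i t] =ᵐ[P] _ :=
      condExp_mul_of_stronglyMeasurable_left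
        (measurable_z_past (d := d) (le_refl t) j).stronglyMeasurable h1 h2
    refine h3.trans ?_
    filter_upwards [hind.2 i t] with ω hω
    simp [hω]

/-- A single individual is a family indexed by `Unit`, so the general deviation inequality applies
with `n = T`. -/
lemma isIndepMartingaleDiff_ε (hmodel : d.SatisfiesModel α η) (hind : d.IndepExogenous P)
    (i : Fin N) :
    IsIndepMartingaleDiff P (fun _ : Unit => d.blockSigma i) (fun _ => d.past i)
      (fun _ => d.ε i) where
  indep := iIndep.of_subsingleton
  le _ := d.blockSigma_le i
  filtration_le _ := past_le_blockSigma hmodel i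
  mono _ _ _ ht := d.past_mono i ht
  measurable _ t := measurable_ε_blockSigma i t
  adapted _ _ _ ht := measurable_ε_past hmodel ht
  condExp_eq_zero _ t := hind.2 i t

lemma measureReal_sum_z_mul_ε_ge_le (hN : 1 ≤ N) (hT : 1 ≤ T) (hC : 0 < C) (hK : 0 < K)
    (h : d.Subgaussian P C K) (hmodel : d.SatisfiesModel α η) (hind : d.IndepExogenous P)
    (j : Fin L ⊕ Fin px) {u : ℝ} (hu : 0 ≤ u) :
    P.real {ω | √(N * T * u ^ 3) ≤ |∑ r : Fin N × Fin T, d.z r.1 r.2 ω j * d.ε r.1 r.2 ω|}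
      ≤ deviationConst C K * Real.exp (-(deviationRate C * u)) := by
  have hN0 : (0 : ℝ) < N := by exact_mod_cast hN
  have hT0 : (0 : ℝ) < T := by exact_mod_cast hT
  have := (isIndepMartingaleDiff_z_mul_ε hC hK h hmodel hind j).measureReal_sum_ge_le
    (by positivity : 0 < C / 2) (fun i t => expMomentLE_z_mul_ε hC hK h i t j)
    (by rw [Fintype.card_fin]; positivity) hu (B := deviationRate C) (min_le_left _ _)
    (min_le_right _ _) (momentBound_pos hC hK).le
  rwa [Fintype.card_fin] at this

lemma measureReal_sum_ε_ge_le (hT : 1 ≤ T) (hC : 0 < C) (hK : 0 < K)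
    (h : d.Subgaussian P C K) (hmodel : d.SatisfiesModel α η) (hind : d.IndepExogenous P)
    (i : Fin N) {u : ℝ} (hu : 0 ≤ u) :
    P.real {ω | √(T * u ^ 3) ≤ |∑ t, d.ε i t ω|}
      ≤ deviationConst C K * Real.exp (-(deviationRate C * u)) := by
  have hT0 : (0 : ℝ) < T := by exact_mod_cast hT
  have := (isIndepMartingaleDiff_ε hmodel hind i).measureReal_sum_ge_le
    (by positivity : 0 < C / 2) (fun _ t => expMomentLE_ε hC hK h i t)
    (by simpa using hT0) hu (B := deviationRate C) (min_le_left _ _)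
    (min_le_right _ _) (momentBound_pos hC hK).le
  unfold deviationConst
  simpa only [Fintype.card_unit, Nat.cast_one, one_mul, Fintype.sum_prod_type,
    Finset.univ_unique, Finset.sum_singleton] using this

lemma measureReal_gram_sub_ge_le (hN : 1 ≤ N) (hT : 1 ≤ T) (hC : 0 < C) (hK : 0 < K)
    (h : d.Subgaussian P C K) (hmodel : d.SatisfiesModel α η) (hind : d.IndepExogenous P)
    (j k : Fin L ⊕ Fin px) {m : ℝ} (hm : 0 ≤ m) :
    P.real {ω | m ≤ |1 / ((N : ℝ) * T) * ∑ r : Fin N × Fin T, d.z r.1 r.2 ω j * d.z r.1 r.2 ω k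
        - d.secondMoment P j k|}
      ≤ deviationConst C K * Real.exp (-(deviationRate C * (N * m ^ 2) ^ (1 / 3 : ℝ))) := by
  have hN0 : (0 : ℝ) < N := by exact_mod_cast hN
  have hT0 : (0 : ℝ) < T := by exact_mod_cast hT
  have hc : 0 < C / 2 := by positivity
  have hb := sqExpBound_pos hC hK
  set A : Fin N → Ω → ℝ := fun i ω => 1 / (T : ℝ) * ∑ t, d.z i t ω j * d.z i t ω k with hA
  have hAmB : ∀ i, Measurable[d.blockSigma i] (A i) := fun i => by
    have h1 := fun t => measurable_z_blockSigma hmodel i t j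
    have h2 := fun t => measurable_z_blockSigma hmodel i t k
    fun_prop
  have hAm : ∀ i, Measurable (A i) := fun i => (hAmB i).mono (d.blockSigma_le i) le_rfl
  have hAmom : ∀ i, ExpMomentLE P (C / 2) (sqExpBound C K) (A i) := fun i =>
    expMomentLE_average hT hc (fun t => (d.measurable_z i t j).mul (d.measurable_z i t k))
      (fun t => expMomentLE_z_mul_z hC hK h i t j k)
  have hAi : ∀ i, Integrable (A i) P := fun i =>
    ((hAmom i).memLp_two hc (hAm i).aestronglyMeasurable).integrable (by norm_num)
  -- The centred time averages of the individuals are treated as sequences of length one with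
  -- trivial filtration, so the sample size is `N`, not `N T`.
  have hmart : IsIndepMartingaleDiff P d.blockSigma (fun _ (_ : Fin 1) => (⊥ : MeasurableSpace Ω))
      (fun i _ ω => A i ω - ∫ ω', A i ω' ∂P) :=
    { indep := hind.1
      le := d.blockSigma_le
      filtration_le := fun _ _ => bot_le
      mono := fun _ _ _ _ => le_rfl
      measurable := fun i _ => (hAmB i).sub measurable_const
      adapted := fun i t' t ht => absurd ht (by simp [Subsingleton.elim t' t])
      condExp_eq_zero := fun i _ => by
        rw [condExp_bot]
        refine ae_of_all _ fun ω => ?_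
        simp [integral_sub (hAi i) (integrable_const _)] }
  have hmom : ∀ i (_ : Fin 1), ExpMomentLE P (C / 2) (momentBound C K)
      (fun ω => A i ω - ∫ ω', A i ω' ∂P) := fun i _ => by
    refine ((hAmom i).sub_integral hc (hAm i)).mono le_rfl ?_
      ((hAm i).sub measurable_const).aestronglyMeasurable
    unfold momentBound
    gcongr
    linarith [Real.exp_pos (C / 2)]
  -- With this `u` the threshold `√(N u³)` equals `N m`.
  have hmain := hmart.measureReal_sum_ge_le hc hmom (by simpa using hN0)
    (u := (N * m ^ 2) ^ (1 / 3 : ℝ)) (by positivity) (B := deviationRate C) (min_le_left _ _)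
    (min_le_right _ _) (momentBound_pos hC hK).le
  refine le_trans (measureReal_mono ?_) hmain
  intro ω hω
  have hzz : ∀ i t, Integrable (fun ω => d.z i t ω j * d.z i t ω k) P := fun i t =>
    ((expMomentLE_z_mul_z hC hK h i t j k).memLp_two hc
      ((d.measurable_z i t j).mul (d.measurable_z i t k)).aestronglyMeasurable).integrable
      (by norm_num)
  have hsum : ∑ r : Fin N × Fin 1, (A r.1 ω - ∫ ω', A r.1 ω' ∂P)
      = N * (1 / ((N : ℝ) * T) * ∑ r : Fin N × Fin T, d.z r.1 r.2 ω j * d.z r.1 r.2 ω k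
        - d.secondMoment P j k) := by
    have hI : ∀ i, ∫ ω', A i ω' ∂P = 1 / (T : ℝ) * ∑ t, ∫ ω, d.z i t ω j * d.z i t ω k ∂P := by
      intro i
      simp only [hA]
      rw [integral_const_mul, integral_finsetSum _ fun t _ => hzz i t]
    simp only [Fintype.sum_prod_type, Finset.univ_unique, Finset.sum_singleton, hI]
    simp only [Finset.sum_sub_distrib, hA, secondMoment, Matrix.of_apply, ← Finset.mul_sum]
    field_simp
  rw [Set.mem_ofPred_eq, hsum, abs_mul, abs_of_pos hN0, Fintype.card_fin, Nat.cast_one, mul_one,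
    rpow_one_third_pow_three (by positivity)]
  have e : (N : ℝ) * (N * m ^ 2) = (N * m) ^ 2 := by ring
  rw [e, Real.sqrt_sq (by positivity)]
  have hω' : m ≤ _ := hω
  gcongr

lemma measureReal_sum_z_ge_le (hT : 1 ≤ T) (hC : 0 < C) (hK : 0 < K) (h : d.Subgaussian P C K)
    (i : Fin N) (j : Fin L ⊕ Fin px) {m : ℝ} (hm : 0 ≤ m) :
    P.real {ω | m * (T * √N) ≤ |∑ t, d.z i t ω j|}
      ≤ momentBound C K * Real.exp (C / 2)
        * Real.exp (-(deviationRate C * (N * m ^ 2) ^ (1 / 3 : ℝ))) := by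
  have hT0 : (0 : ℝ) < T := by exact_mod_cast hT
  have hc : 0 < C / 2 := by positivity
  have hb := momentBound_pos hC hK
  have havg := expMomentLE_average hT hc (fun t => d.measurable_z i t j)
    (fun t => expMomentLE_z hC hK h i t j)
  have h1 := havg.measureReal_le hc (m * √N)
  set u : ℝ := (N * m ^ 2) ^ (1 / 3 : ℝ) with hu
  have hu0 : 0 ≤ u := by positivity
  have hu3 : u ^ 3 = (m * √N) ^ 2 := by
    rw [hu, rpow_one_third_pow_three (by positivity), mul_pow, Real.sq_sqrt (by positivity)]
    ring
  -- Markov's inequality gives an exponent linear in `m √N = u^(3/2)`. It dominates `u` up to the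
  -- shift by one, which costs the factor `exp (C / 2)`.
  have hle : u - 1 ≤ m * √N := by
    by_contra hcon
    push Not at hcon
    have h2 : 0 ≤ m * √N := by positivity
    nlinarith [sq_nonneg (u - 1)]
  have hset : {ω | m * (T * √N) ≤ |∑ t, d.z i t ω j|}
      = {ω | m * √N ≤ |1 / (T : ℝ) * ∑ t, d.z i t ω j|} := by
    ext ω
    rw [Set.mem_ofPred_eq, Set.mem_ofPred_eq, abs_mul, abs_of_pos (by positivity : 0 < 1 / (T : ℝ)),
      one_div_mul_eq_div, le_div_iff₀ hT0]
    ring_nf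
  rw [hset]
  refine h1.trans ?_
  rw [mul_assoc, ← Real.exp_add]
  gcongr
  have hr : deviationRate C ≤ C / 2 := (min_le_right _ _).trans (by linarith)
  nlinarith

end Deviations

end PanelData

/-- A union bound over `q` events multiplies the tail by `q`; since `ℓ ≥ log q`, the exponential
becomes a power of `q`. -/
lemma mul_exp_neg_le_rpow {q ℓ B₀ B x : ℝ} (hq : 1 ≤ q) (hℓ : Real.log q ≤ ℓ) (hB : 0 ≤ B)
    (hBB : B ≤ B₀) (hx : 0 ≤ x) : q * Real.exp (-(B₀ * (x * ℓ))) ≤ q ^ (1 - B * x) := by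
  have hq0 : 0 < q := by linarith
  have hlog : 0 ≤ Real.log q := Real.log_nonneg hq
  rw [Real.rpow_sub hq0, Real.rpow_one, div_eq_mul_inv, ← Real.rpow_neg hq0.le,
    Real.rpow_def_of_pos hq0]
  have hB₀ : 0 ≤ B₀ := hB.trans hBB
  gcongr
  have h1 : B * (x * Real.log q) ≤ B₀ * (x * ℓ) := by gcongr
  linarith

/-! ### The good event and the union bound. -/

section Event

variable {Ω : Type*} [MeasurableSpace Ω] {P : Measure Ω} [IsProbabilityMeasure P]
  {N T L px : ℕ}

/-- The event on which the noise terms are below the levels `a` and `b`, and the scaled Gram matrix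
is entrywise within `m` of its population counterpart. -/
def controlEvent (d : PanelData Ω N T L px)
    (Ψ : Matrix (Fin L ⊕ Fin px) (Fin L ⊕ Fin px) ℝ) (a b m : ℝ) : Set Ω :=
  {ω | (∀ j, |∑ r : Fin N × Fin T, d.z r.1 r.2 ω j * d.ε r.1 r.2 ω| ≤ a) ∧
    (∀ i, |∑ t, d.ε i t ω| ≤ b) ∧
    (∀ j k, |1 / ((N : ℝ) * T) * ∑ r : Fin N × Fin T, d.z r.1 r.2 ω j * d.z r.1 r.2 ω k
      - Ψ j k| ≤ m) ∧
    ∀ j i, |∑ t, d.z i t ω j| ≤ m * (T * √N)}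

lemma measurableSet_controlEvent (d : PanelData Ω N T L px)
    (Ψ : Matrix (Fin L ⊕ Fin px) (Fin L ⊕ Fin px) ℝ) (a b m : ℝ) :
    MeasurableSet (controlEvent d Ψ a b m) := by
  have hz := d.measurable_z
  have hε := d.measurable_ε
  have h1 : ∀ j, MeasurableSet
      {ω | |∑ r : Fin N × Fin T, d.z r.1 r.2 ω j * d.ε r.1 r.2 ω| ≤ a} := fun j =>
    measurableSet_le (by fun_prop) measurable_const
  have h2 : ∀ i, MeasurableSet {ω | |∑ t, d.ε i t ω| ≤ b} := fun i =>
    measurableSet_le (by fun_prop) measurable_const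
  have h3 : ∀ j k, MeasurableSet
      {ω | |1 / ((N : ℝ) * T) * ∑ r : Fin N × Fin T, d.z r.1 r.2 ω j * d.z r.1 r.2 ω k
        - Ψ j k| ≤ m} := fun j k =>
    measurableSet_le (by fun_prop) measurable_const
  have h4 : ∀ j i, MeasurableSet {ω | |∑ t, d.z i t ω j| ≤ m * (T * √N)} := fun j i =>
    measurableSet_le (by fun_prop) measurable_const
  have e : controlEvent d Ψ a b m
      = (⋂ j, {ω | |∑ r : Fin N × Fin T, d.z r.1 r.2 ω j * d.ε r.1 r.2 ω| ≤ a})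
        ∩ ((⋂ i, {ω | |∑ t, d.ε i t ω| ≤ b})
        ∩ ((⋂ j, ⋂ k, {ω | |1 / ((N : ℝ) * T) * ∑ r : Fin N × Fin T,
          d.z r.1 r.2 ω j * d.z r.1 r.2 ω k - Ψ j k| ≤ m})
        ∩ ⋂ j, ⋂ i, {ω | |∑ t, d.z i t ω j| ≤ m * (T * √N)})) := by
    ext ω
    simp [controlEvent]
  rw [e]
  exact (MeasurableSet.iInter h1).inter ((MeasurableSet.iInter h2).inter
    ((MeasurableSet.iInter fun j => MeasurableSet.iInter (h3 j)).inter
      (MeasurableSet.iInter fun j => MeasurableSet.iInter (h4 j))))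

lemma one_sub_le_measureReal_controlEvent (d : PanelData Ω N T L px)
    (Ψ : Matrix (Fin L ⊕ Fin px) (Fin L ⊕ Fin px) ℝ) {a b m p₁ p₂ p₃ p₄ : ℝ}
    (h1 : ∀ j, P.real {ω | a ≤ |∑ r : Fin N × Fin T, d.z r.1 r.2 ω j * d.ε r.1 r.2 ω|} ≤ p₁)
    (h2 : ∀ i, P.real {ω | b ≤ |∑ t, d.ε i t ω|} ≤ p₂)
    (h3 : ∀ j k, P.real {ω | m ≤ |1 / ((N : ℝ) * T) * ∑ r : Fin N × Fin T,
      d.z r.1 r.2 ω j * d.z r.1 r.2 ω k - Ψ j k|} ≤ p₃)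
    (h4 : ∀ j i, P.real {ω | m * (T * √N) ≤ |∑ t, d.z i t ω j|} ≤ p₄) :
    1 - ((L + px : ℕ) * p₁ + N * p₂ + ((L + px : ℕ) : ℝ) ^ 2 * p₃ + (L + px : ℕ) * N * p₄)
      ≤ P.real (controlEvent d Ψ a b m) := by
  have hsub : (controlEvent d Ψ a b m)ᶜ
      ⊆ (((⋃ j, {ω | a ≤ |∑ r : Fin N × Fin T, d.z r.1 r.2 ω j * d.ε r.1 r.2 ω|})
        ∪ ⋃ i, {ω | b ≤ |∑ t, d.ε i t ω|})
        ∪ ⋃ q : (Fin L ⊕ Fin px) × (Fin L ⊕ Fin px), {ω | m ≤ |1 / ((N : ℝ) * T) *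
          ∑ r : Fin N × Fin T, d.z r.1 r.2 ω q.1 * d.z r.1 r.2 ω q.2 - Ψ q.1 q.2|})
        ∪ ⋃ q : (Fin L ⊕ Fin px) × Fin N, {ω | m * (T * √N) ≤ |∑ t, d.z q.2 t ω q.1|} := by
    intro ω hω
    by_contra hcon
    simp only [Set.mem_union, Set.mem_iUnion, Set.mem_ofPred_eq, not_or, not_exists, not_le,
      Prod.forall] at hcon
    exact hω ⟨fun j => (hcon.1.1.1 j).le, fun i => (hcon.1.1.2 i).le,
      fun j k => (hcon.1.2 j k).le, fun j i => (hcon.2 j i).le⟩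
  have hcompl : P.real (controlEvent d Ψ a b m)ᶜ
      ≤ (L + px : ℕ) * p₁ + N * p₂ + ((L + px : ℕ) : ℝ) ^ 2 * p₃ + (L + px : ℕ) * N * p₄ := by
    refine (measureReal_mono hsub).trans ((measureReal_union_le _ _).trans (add_le_add
      ((measureReal_union_le _ _).trans (add_le_add ((measureReal_union_le _ _).trans
        (add_le_add ?_ ?_)) ?_)) ?_))
    · refine (measureReal_iUnion_fintype_le _).trans ((Finset.sum_le_sum fun j _ => h1 j).trans ?_)
      simp
    · refine (measureReal_iUnion_fintype_le _).trans ((Finset.sum_le_sum fun i _ => h2 i).trans ?_)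
      simp
    · refine (measureReal_iUnion_fintype_le _).trans
        ((Finset.sum_le_sum fun q _ => h3 q.1 q.2).trans ?_)
      simp [pow_two]
    · refine (measureReal_iUnion_fintype_le _).trans
        ((Finset.sum_le_sum fun q _ => h4 q.1 q.2).trans ?_)
      simp
  have := probReal_compl_eq_one_sub (μ := P) (measurableSet_controlEvent d Ψ a b m)
  linarith

end Event

/-! ### Choice of constants and conclusion. -/

theorem theorem1
    -- the constants `A`, `B` depend only on those of the assumptions
    (C K κ₀ C₀ : ℝ) (hC : 0 < C) (hK : 0 < K) (hκ₀ : 0 < κ₀) (hC₀ : 0 < C₀) :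
    ∃ A B : ℝ, 0 < A ∧ 0 < B ∧
      ∀ (N T L px p s₁ : ℕ) (M ν E lam Ξ : ℝ),
        1 ≤ N → 1 ≤ T → p = L + px → 1 ≤ s₁ → s₁ ≤ p →
        0 < M → 0 ≤ ν → ν < 1 → 0 < E →
        lam = lambdaN M N T p → Ξ = lam / (√N * T) →
        s₁ + E * Ξ ^ (-ν) ≤ C₀ * √N →
      ∀ (Ω : Type*) [MeasurableSpace Ω] (P : Measure Ω) [IsProbabilityMeasure P]
        (d : PanelData Ω N T L px) (α : Fin L ⊕ Fin px → ℝ) (η : Fin N → ℝ) (κsq : ℝ),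
        (α, η) ∈ sparseClass N s₁ ν E →
        d.SatisfiesModel α η →
        d.IndepExogenous P →
        κsq = kappaSq (d.secondMoment P) s₁ → κ₀ ≤ κsq →
        d.Subgaussian P C K →
      ∃ G : Set Ω, MeasurableSet G ∧
        1 - A * (p : ℝ) ^ (1 - B * M ^ (1 / 3 : ℝ)) - A * (N : ℝ) ^ (1 - B * M ^ (1 / 3 : ℝ))
            - A * ((p : ℝ) ^ 2 + p * N)
              * Real.exp (-B * ((N : ℝ) / (s₁ + E * Ξ ^ (-ν)) ^ 2) ^ (1 / 3 : ℝ))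
          ≤ P.real G ∧
        ∀ ω ∈ G, ∀ (αhat : Fin L ⊕ Fin px → ℝ) (ηhat : Fin N → ℝ),
          IsPanelLasso d lam ω αhat ηhat →
          1 / ((N : ℝ) * T) * sqNorm (d.design ω *ᵥ (Sum.elim αhat ηhat - Sum.elim α η))
              ≤ 120 * lam ^ 2 * s₁ / (κsq * ((N : ℝ) * T) ^ 2)
                + (120 / κsq + 20) * (lam / (√N * N * T)) * E * Ξ ^ (1 - ν) ∧
          l1Norm (αhat - α)
              ≤ 120 * lam * s₁ / (κsq * N * T)
                + (120 / κsq + 20) * (1 / √N) * E * Ξ ^ (1 - ν) ∧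
          l1Norm (ηhat - η)
              ≤ 120 * lam * s₁ / (κsq * √N * T)
                + (120 / κsq + 20) * E * Ξ ^ (1 - ν) := by
  have hA₁ := PanelData.deviationConst_pos hC hK
  have hB₁ := PanelData.deviationRate_pos hC
  have hb := PanelData.momentBound_pos hC hK
  set A₁ := PanelData.deviationConst C K with hA₁def
  set B₁ := PanelData.deviationRate C with hB₁def
  set A₂ := PanelData.momentBound C K * Real.exp (C / 2) with hA₂def
  have hA₂ : 0 < A₂ := by positivity
  -- With `m = κ₀ / (256 s)` below, `N m² = (κ₀/256)² N / s²`; its cube root carries this factor.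
  set c : ℝ := ((κ₀ / 256) ^ 2) ^ (1 / 3 : ℝ) with hcdef
  have hc : 0 < c := by positivity
  refine ⟨A₁ + A₂ + 1, min B₁ (B₁ * c), by positivity, lt_min hB₁ (by positivity), ?_⟩
  set A := A₁ + A₂ + 1 with hA
  set B := min B₁ (B₁ * c) with hB
  have hB0 : 0 < B := lt_min hB₁ (by positivity)
  intro N T L px p s₁ M ν E lam Ξ hN hT hp hs₁ hs₁p hM hν hν1 hE hlam hΞ _ Ω _ P _ d α η κsq hsparse
    hmodel hind hκsq hκ hsub
  have hN0 : (0 : ℝ) < N := by exact_mod_cast hN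
  have hT0 : (0 : ℝ) < T := by exact_mod_cast hT
  have hp1 : 1 ≤ p := hs₁.trans hs₁p
  have hN1 : (1 : ℝ) ≤ N := by exact_mod_cast hN
  have hp1' : (1 : ℝ) ≤ p := by exact_mod_cast hp1
  -- If `p = N = 1`, the logarithm and hence `lam` vanish. The claimed probability is then at most
  -- `1 - 2A < 0`, thanks to the summand `1` in `A`, and the empty event will do.
  rcases (le_max_of_le_left hp1' : (1 : ℝ) ≤ max (p : ℝ) N).eq_or_lt with hmax | hmax
  · have hpe : (p : ℝ) = 1 := le_antisymm (hmax ▸ le_max_left _ _) hp1'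
    have hNe : (N : ℝ) = 1 := le_antisymm (hmax ▸ le_max_right _ _) hN1
    refine ⟨∅, MeasurableSet.empty, ?_, fun ω hω => absurd hω (Set.notMem_empty ω)⟩
    rw [hpe, hNe, measureReal_empty, Real.one_rpow]
    have : 0 ≤ A * ((1 : ℝ) ^ 2 + 1 * 1)
        * Real.exp (-B * (1 / (s₁ + E * Ξ ^ (-ν)) ^ 2) ^ (1 / 3 : ℝ)) := by positivity
    linarith
  set ℓ := Real.log (max (p : ℝ) N) with hℓ
  have hℓ0 : 0 < ℓ := Real.log_pos hmax
  have hlam0 : 0 < lam := by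
    rw [hlam, lambdaN]
    positivity
  have hΞ0 : 0 < Ξ := by rw [hΞ]; positivity
  set x : ℝ := M ^ (1 / 3 : ℝ) with hx
  have hx0 : 0 ≤ x := by positivity
  have hx3 : x ^ 3 = M := rpow_one_third_pow_three hM.le
  set u := x * ℓ with hu
  have hu0 : 0 ≤ u := by positivity
  -- The factor `4` and the cube in `lambdaN` make half of each penalty weight a deviation threshold
  -- at the same `u = M^(1/3) log (p ∨ N)`.
  have hlam2 : lam / 2 = √(N * T * u ^ 3) := by
    have e : 4 * M * N * T * ℓ ^ 3 = 2 ^ 2 * (N * T * u ^ 3) := by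
      rw [hu, mul_pow, hx3]
      ring
    rw [hlam, lambdaN, e, Real.sqrt_mul (by positivity), Real.sqrt_sq (by norm_num)]
    ring
  have hlam3 : lam / √N / 2 = √(T * u ^ 3) := by
    have e : lam / √N / 2 = lam / 2 / √N := by ring
    rw [e, hlam2, mul_assoc, Real.sqrt_mul hN0.le]
    field_simp
  set s := (s₁ : ℝ) + E * Ξ ^ (-ν) with hs
  have hs0 : 0 < s := by positivity
  -- The largest deviation that `256 m s ≤ κsq` allows for every `κsq ≥ κ₀`.
  set m := κ₀ / (256 * s) with hm
  have hm0 : 0 < m := by positivity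
  have hms : 256 * m * s = κ₀ := by
    rw [hm]
    field_simp
  have hw : (N * m ^ 2) ^ (1 / 3 : ℝ) = c * ((N : ℝ) / s ^ 2) ^ (1 / 3 : ℝ) := by
    rw [hcdef, ← Real.mul_rpow (by positivity) (by positivity), hm]
    congr 1
    field_simp
  set w := ((N : ℝ) / s ^ 2) ^ (1 / 3 : ℝ) with hwdef
  have hw0 : 0 ≤ w := by positivity
  refine ⟨controlEvent d (d.secondMoment P) (lam / 2) (lam / √N / 2) m,
    measurableSet_controlEvent _ _ _ _ _, ?_, ?_⟩
  · have h0 := one_sub_le_measureReal_controlEvent (P := P) d (d.secondMoment P)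
      (a := lam / 2) (b := lam / √N / 2) (m := m)
      (fun j => by
        rw [hlam2]
        exact PanelData.measureReal_sum_z_mul_ε_ge_le hN hT hC hK hsub hmodel hind j hu0)
      (fun i => by
        rw [hlam3]
        exact PanelData.measureReal_sum_ε_ge_le hT hC hK hsub hmodel hind i hu0)
      (fun j k => PanelData.measureReal_gram_sub_ge_le hN hT hC hK hsub hmodel hind j k hm0.le)
      (fun j i => PanelData.measureReal_sum_z_ge_le hT hC hK hsub i j hm0.le)
    rw [← hp, hw, ← hA₁def, ← hB₁def, ← hA₂def] at h0
    refine le_trans ?_ h0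
    have k1 := mul_exp_neg_le_rpow hp1' (Real.log_le_log (by positivity) (le_max_left (p : ℝ) N))
      hB0.le (min_le_left B₁ (B₁ * c)) hx0
    have k2 := mul_exp_neg_le_rpow hN1 (Real.log_le_log (by positivity) (le_max_right (p : ℝ) N))
      hB0.le (min_le_left B₁ (B₁ * c)) hx0
    have k3 : Real.exp (-(B₁ * (c * w))) ≤ Real.exp (-B * w) := by
      apply Real.exp_le_exp.2
      have := mul_le_mul_of_nonneg_right (min_le_right B₁ (B₁ * c)) hw0
      rw [← hB] at this
      linarith
    have hAA₁ : A₁ ≤ A := by linarith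
    have hAA₂ : A₂ ≤ A := by linarith
    have j1 : p * (A₁ * Real.exp (-(B₁ * u))) ≤ A * (p : ℝ) ^ (1 - B * x) := by
      calc _ = A₁ * (p * Real.exp (-(B₁ * u))) := by ring
        _ ≤ _ := by gcongr
    have j2 : N * (A₁ * Real.exp (-(B₁ * u))) ≤ A * (N : ℝ) ^ (1 - B * x) := by
      calc _ = A₁ * (N * Real.exp (-(B₁ * u))) := by ring
        _ ≤ _ := by gcongr
    have j3 : (p : ℝ) ^ 2 * (A₁ * Real.exp (-(B₁ * (c * w)))) + p * N *
        (A₂ * Real.exp (-(B₁ * (c * w)))) ≤ A * ((p : ℝ) ^ 2 + p * N) * Real.exp (-B * w) := by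
      calc _ ≤ (p : ℝ) ^ 2 * (A * Real.exp (-B * w)) + p * N * (A * Real.exp (-B * w)) := by gcongr
        _ = _ := by ring
    linarith
  · rintro ω ⟨hZ, hD, hΨ, hZD⟩ αhat ηhat hL
    exact oracle_inequalities_of_controlled hN hT hmodel hs₁ hν hν1 hlam0 hE hΞ hsparse hκsq
      (hκ₀.trans_le hκ) hm0.le (hms.le.trans hκ) hZ hD hΨ hZD hL
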